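/- Let $n$ be a positive integer and $R$ a commutative ring. Let $\mathrm{Par}(n)$ be the set of partitions of $n$ with the dominance partial order $\trianglelefteq$ ($\lambda\trianglelefteq\mu$ iff $\lambda_1+\dots+\lambda_k\le\mu_1+\dots+\mu_k$ for all $k$); for $\lambda\in\mathrm{Par}(n)$ let $\lambda^*$ be the transpose partition and $f_\lambda$ the number of standard $\lambda$-tableaux, and put $\Gamma^*=\{\lambda^*\mid\lambda\in\Gamma\}$ for $\Gamma\subseteq\mathrm{Par}(n)$. Let $G(\Gamma)$ be the set of permutations $\sigma\in\mathrm{Sym}(n)$ such that the shape of the tableaux assigned to the word $\sigma(1)\sigma(2)\dots\sigma(n)$ by the Robinson--Schensted correspondence (row insertion) lies in $\Gamma$, and let $RG(\Gamma)$ be its $R$-span in the group algebra $R\,\mathrm{Sym}(n)$. For $\lambda=(\lambda_1,\dots,\lambda_m)\in\mathrm{Par}(n)$ let $\mathrm{Sym}(\lambda)=\mathrm{Sym}(X_1)\times\dots\times\mathrm{Sym}(X_m)\le\mathrm{Sym}(n)$, where $X_1=\{1,\dots,\lambda_1\}$, $X_2=\{\lambda_1+1,\dots,\lambda_1+\lambda_2\}$,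 and so on. For $\Delta\subseteq\mathrm{Par}(n)$ let $I_R(\Delta)$ be the two-sided ideal of $R\,\mathrm{Sym}(n)$ generated by the elements $\sum_{\sigma\in\mathrm{Sym}(\lambda)}\sigma$, $\lambda\in\Delta$. Let ${}^\dagger$ be the $R$-algebra automorphism of $R\,\mathrm{Sym}(n)$ with $\sigma^\dagger=\mathrm{sgn}(\sigma)\sigma$ for $\sigma\in\mathrm{Sym}(n)$, and let $I_R(\Delta)^\dagger$ be the image of $I_R(\Delta)$ under it. Let $\Gamma\subseteq\mathrm{Par}(n)$ be co-saturated (if $\mu\in\Gamma$ and $\mu\trianglelefteq\lambda$ then $\lambda\in\Gamma$) with a unique minimal element, and let $\Delta=\mathrm{Par}(n)\setminus\Gamma^*$. Then: (i) $R\,\mathrm{Sym}(n)=RG(\Gamma)\oplus I_R(\Delta)=RG(\Gamma)\oplus I_R(\Delta)^\dagger$ as $R$-modules. (ii) $I_R(\Delta)$ (resp. $I_R(\Delta)^\dagger$) is a free $R$-module of rank $\sum_{\lambda\in\Delta}f_\lambda^2$, and the natural map $R\otimes_{\mathbb Z}I_{\mathbb Z}(\Delta)\to I_R(\Delta)$ (resp.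 $R\otimes_{\mathbb Z}I_{\mathbb Z}(\Delta)^\dagger\to I_R(\Delta)^\dagger$), which sends $r\otimes x$ to $r$ times the image of $x$ in $R\,\mathrm{Sym}(n)$, is an isomorphism of $R$-modules. -/

import Mathlib

open scoped TensorProduct

/-! ## Partitions, the dominance order, conjugate partitions -/

namespace Nat.Partition

variable {n : ℕ}

/-- The parts of a partition in weakly decreasing order. -/
def rows (l : n.Partition) : List ℕ := l.parts.sort (· ≥ ·)

theorem rows_sortedGE (l : n.Partition) : l.rows.SortedGE :=
  (l.parts.pairwise_sort (· ≥ ·)).sortedGE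

theorem coe_rows (l : n.Partition) : (l.rows : Multiset ℕ) = l.parts :=
  Multiset.sort_eq _ _

/-- The sum of the first `k` (largest) parts. -/
def partialSum (l : n.Partition) (k : ℕ) : ℕ := (l.rows.take k).sum

theorem list_eq_of_take_sum : ∀ (a b : List ℕ), (∀ x ∈ a, 0 < x) → (∀ x ∈ b, 0 < x) →
    (∀ k, (a.take k).sum = (b.take k).sum) → a = b
  | [], [], _, _, _ => rfl
  | [], y :: ys, _, hb, h => by
      have h1 := h 1
      have h2 := hb y (by simp)
      simp at h1
      omega
  | x :: xs, [], ha, _, h => by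
      have h1 := h 1
      have h2 := ha x (by simp)
      simp at h1
      omega
  | x :: xs, y :: ys, ha, hb, h => by
      have hxy : x = y := by simpa using h 1
      subst hxy
      rw [list_eq_of_take_sum xs ys (fun z hz => ha z (by simp [hz]))
        (fun z hz => hb z (by simp [hz])) (fun k => by simpa using h (k + 1))]

theorem pos_of_mem_rows (l : n.Partition) (x : ℕ) (hx : x ∈ l.rows) : 0 < x := by
  apply l.parts_pos
  rw [← l.coe_rows]
  exact hx

/-- The dominance order: `l ≤ m` if and only if `l₁ + ⋯ + lₖ ≤ m₁ + ⋯ + mₖ` for all `k`. -/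
instance dominanceOrder : PartialOrder n.Partition where
  le l m := ∀ k, l.partialSum k ≤ m.partialSum k
  le_refl _ _ := le_rfl
  le_trans _ _ _ h₁ h₂ k := (h₁ k).trans (h₂ k)
  le_antisymm l m h₁ h₂ := by
    have h : l.rows = m.rows :=
      list_eq_of_take_sum _ _ l.pos_of_mem_rows m.pos_of_mem_rows
        (fun k => le_antisymm (h₁ k) (h₂ k))
    ext1
    rw [← l.coe_rows, ← m.coe_rows, h]

theorem sum_card_filter_lt (n : ℕ) (s : Multiset ℕ) (hs : ∀ x ∈ s, x ≤ n) :
    ((Multiset.range n).map fun j => (s.filter (j < ·)).card).sum = s.sum := by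
  induction s using Multiset.induction_on with
  | empty => simp
  | cons a s ih =>
    have ha : a ≤ n := hs a (by simp)
    have key : ((Multiset.range n).map fun j => if j < a then 1 else 0).sum = a := by
      change ∑ j ∈ Finset.range n, (if j < a then 1 else 0) = a
      rw [← Finset.sum_filter]
      have : (Finset.range n).filter (· < a) = Finset.range a := by
        ext j
        simp only [Finset.mem_filter, Finset.mem_range]
        omega
      simp [this]
    have e : (fun j => ((a ::ₘ s).filter (j < ·)).card)
        = fun j => (if j < a then 1 else 0) + (s.filter (j < ·)).card := by
      funext j
      by_cases h : j < a
      · simp [h, add_comm]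
      · simp [h]
    rw [e, Multiset.sum_map_add, key, ih (fun x hx => hs x (by simp [hx])), Multiset.sum_cons]

/-- The conjugate (transpose) partition: its parts are the numbers
`#{i | lᵢ > j}` for `j = 0, 1, …`, as long as they are nonzero. -/
def conj (l : n.Partition) : n.Partition :=
  ofSums n ((Multiset.range n).map fun j => (l.parts.filter (j < ·)).card)
    ((sum_card_filter_lt n l.parts (fun _ h => le_of_mem_parts h)).trans l.parts_sum)

/-- The Young diagram of a partition. -/
def diagram (l : n.Partition) : YoungDiagram := YoungDiagram.ofRowLens l.rows l.rows_sortedGE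

/-- Standard tableaux of shape `l`: bijective fillings of the cells `(i, j)` (row `i`, column `j`)
by `Fin n`, strictly increasing along the rows and down the columns. -/
def StandardTableau (l : n.Partition) : Type :=
  {T : l.diagram.cells ≃ Fin n //
    (∀ c d : l.diagram.cells, c.1.1 = d.1.1 → c.1.2 < d.1.2 → T c < T d) ∧
    (∀ c d : l.diagram.cells, c.1.2 = d.1.2 → c.1.1 < d.1.1 → T c < T d)}

/-- The number `f_l` of standard tableaux of shape `l`. -/
noncomputable def numStandard (l : n.Partition) : ℕ := Nat.card l.StandardTableau

/-- The `k`-th block (`k = 0, 1, …`) of consecutive elements, of size the `k`-th part of `l`. -/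
def block (l : n.Partition) (k : ℕ) : Set (Fin n) :=
  {i | l.partialSum k ≤ i ∧ (i : ℕ) < l.partialSum (k + 1)}

/-- The Young subgroup `Sym(l)`: the permutations that preserve every block of `l`. -/
def youngSubgroup (l : n.Partition) : Subgroup (Equiv.Perm (Fin n)) where
  carrier := {σ | ∀ k i, σ i ∈ l.block k ↔ i ∈ l.block k}
  one_mem' _ _ := Iff.rfl
  mul_mem' {_ τ} hσ hτ k i := (hσ k (τ i)).trans (hτ k i)
  inv_mem' {σ} hσ k i := by
    rw [← hσ k (σ⁻¹ i)]
    simp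

end Nat.Partition

/-! ## The Robinson–Schensted shape -/

namespace RobinsonSchensted

/-- Schensted insertion of `x` into a row: `x` replaces the first entry that is larger than `x`,
and this entry is returned; if there is none, `x` is put at the end of the row. -/
def rowInsert (x : ℕ) : List ℕ → List ℕ × Option ℕ
  | [] => ([x], none)
  | y :: ys =>
    if x < y then (x :: ys, some y) else (y :: (rowInsert x ys).1, (rowInsert x ys).2)

/-- Schensted insertion into a tableau (a list of rows): an entry that is bumped from a row is
inserted into the next row. -/
def tableauInsert (x : ℕ) : List (List ℕ) → List (List ℕ)
  | [] => [[x]]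
  | r :: rs =>
    match (rowInsert x r).2 with
    | none => (rowInsert x r).1 :: rs
    | some y => (rowInsert x r).1 :: tableauInsert y rs

/-- The insertion tableau of a word. -/
def insertionTableau (w : List ℕ) : List (List ℕ) :=
  w.foldl (fun T x => tableauInsert x T) []

theorem length_rowInsert (x : ℕ) (r : List ℕ) :
    (rowInsert x r).1.length + (rowInsert x r).2.toList.length = r.length + 1 := by
  induction r with
  | nil => simp [rowInsert]
  | cons y ys ih =>
    by_cases h : x < y
    · simp [rowInsert, h]
    · simp only [rowInsert, h, if_false, List.length_cons]
      omega

theorem sum_length_tableauInsert (T : List (List ℕ)) (x : ℕ) :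
    ((tableauInsert x T).map List.length).sum = (T.map List.length).sum + 1 := by
  induction T generalizing x with
  | nil => simp [tableauInsert]
  | cons r rs ih =>
    have h := length_rowInsert x r
    rw [tableauInsert]
    split
    · rename_i h'
      simp [h'] at h
      simp [h]
      omega
    · rename_i y h'
      simp [h'] at h
      simp [h, ih]
      omega

theorem sum_length_foldl (w : List ℕ) (T : List (List ℕ)) :
    ((w.foldl (fun T x => tableauInsert x T) T).map List.length).sum
      = (T.map List.length).sum + w.length := by
  induction w generalizing T with
  | nil => simp
  | cons x w ih =>
    rw [List.foldl_cons, ih, sum_length_tableauInsert, List.length_cons]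
    omega

/-- The word `σ(1) … σ(n)` of a permutation. -/
def word {n : ℕ} (σ : Equiv.Perm (Fin n)) : List ℕ := List.ofFn fun i => (σ i : ℕ)

/-- The Robinson–Schensted shape of (the word of) a permutation: the partition formed by
the row lengths of its insertion tableau. -/
def shape {n : ℕ} (σ : Equiv.Perm (Fin n)) : n.Partition :=
  Nat.Partition.ofSums n (((insertionTableau (word σ)).map List.length : List ℕ) : Multiset ℕ)
    (by rw [Multiset.sum_coe, insertionTableau, sum_length_foldl]; simp [word])

end RobinsonSchensted

/-! ## Submodules of the group algebra of the symmetric group -/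

namespace SymGroupAlgebra

variable {n : ℕ} (R : Type*) [CommRing R]

/-- `R G(Γ)`: the `R`-span of the permutations whose shape lies in `Γ`. -/
noncomputable def spanG (Γ : Finset n.Partition) : Submodule R (MonoidAlgebra R (Equiv.Perm (Fin n))) :=
  Submodule.span R (MonoidAlgebra.of R _ '' {σ | RobinsonSchensted.shape σ ∈ Γ})

open Classical in
/-- `[H]`: the sum of the elements of `H` in the group algebra. -/
noncomputable def groupSum (H : Subgroup (Equiv.Perm (Fin n))) :
    MonoidAlgebra R (Equiv.Perm (Fin n)) :=
  ∑ σ : Equiv.Perm (Fin n) with σ ∈ H, MonoidAlgebra.of R _ σ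

/-- `I_R(Δ)`: the two-sided ideal generated by the sums `[Sym(l)]` for `l ∈ Δ`,
as an `R`-submodule of the group algebra. -/
noncomputable def youngIdeal (Δ : Finset n.Partition) :
    Submodule R (MonoidAlgebra R (Equiv.Perm (Fin n))) :=
  (TwoSidedIdeal.span {x | ∃ l ∈ Δ, x = groupSum R l.youngSubgroup}).asIdeal.restrictScalars R

/-- The `R`-algebra endomorphism of the group algebra that underlies `†`: `σ ↦ sgn(σ) σ`. -/
noncomputable def daggerHom :
    MonoidAlgebra R (Equiv.Perm (Fin n)) →ₐ[R] MonoidAlgebra R (Equiv.Perm (Fin n)) :=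
  MonoidAlgebra.lift R _ _
    { toFun := fun σ => MonoidAlgebra.single σ (((Equiv.Perm.sign σ : ℤ) : R))
      map_one' := by simp [MonoidAlgebra.one_def]
      map_mul' := fun σ τ => by simp [MonoidAlgebra.single_mul_single] }

theorem daggerHom_single (σ : Equiv.Perm (Fin n)) (r : R) :
    daggerHom R (MonoidAlgebra.single σ r)
      = MonoidAlgebra.single σ (r * ((Equiv.Perm.sign σ : ℤ) : R)) := by
  simp [daggerHom, MonoidAlgebra.lift_single]

theorem daggerHom_comp :
    (daggerHom R).comp (daggerHom R) = AlgHom.id R (MonoidAlgebra R (Equiv.Perm (Fin n))) := by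
  ext σ : 2
  rcases Int.units_eq_one_or (Equiv.Perm.sign σ) with h | h <;>
    simp [daggerHom_single, h]

/-- The `R`-algebra automorphism `†` of the group algebra, `σ† = sgn(σ) σ`. -/
noncomputable def dagger :
    MonoidAlgebra R (Equiv.Perm (Fin n)) ≃ₐ[R] MonoidAlgebra R (Equiv.Perm (Fin n)) :=
  AlgEquiv.ofAlgHom (daggerHom R) (daggerHom R) (daggerHom_comp R) (daggerHom_comp R)

/-- `I_R(Δ)†`. -/
noncomputable def youngIdealDagger (Δ : Finset n.Partition) :
    Submodule R (MonoidAlgebra R (Equiv.Perm (Fin n))) :=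
  (youngIdeal R Δ).map ((dagger R).toLinearMap)

/-- The ring homomorphism `ℤ Sym(n) → R Sym(n)` that changes the coefficients. -/
noncomputable def fromInt :
    MonoidAlgebra ℤ (Equiv.Perm (Fin n)) →+* MonoidAlgebra R (Equiv.Perm (Fin n)) :=
  MonoidAlgebra.mapRingHom _ (Int.castRingHom R)

end SymGroupAlgebra

/-!
For a pair of standard tableaux `(s, t)` of the same shape `λ`, the *row sum* is the sum of the
permutations that carry the rows of `t` to the rows of `s`, a two-sided translate of `[Sym(λ)]`,
and the *column form* is the signed sum of the coefficients at the permutations that carry the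
columns of `t` to the columns of `s`. The column forms and the row sums are in unitriangular
position with respect to the dominance order of tableaux. As the Robinson–Schensted correspondence
gives `n! ≤ ∑ f_λ ^ 2`, the row sums form a basis of `R Sym(n)` over every `R`. If `Δ` is an upper
set, the column forms of the shapes outside `Δ` vanish on `I_R(Δ)`, so that the row sums of the
shapes in `Δ` form a basis of `I_R(Δ)`.

For the complement, let `R` first be a field, and consider the lexicographically largest permutation
`σ` in the support of an element of the ideal of `{λ | λ*_1 + ⋯ + λ*_k < m}`. A colouring of the
entries of `σ` whose classes are increasing subwords, the first `k` of them covering at least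
`(shape σ)_1 + ⋯ + (shape σ)_k` entries, yields a signed form whose smallest permutation is `σ`, and
this form vanishes on the ideal unless `(shape σ)_1 + ⋯ + (shape σ)_k < m`. So the leading
permutations satisfy this inequality, and by counting they are all the permutations that do. Taking
the union over `k`, and again counting, the leading permutations of the ideal of `{λ | ¬ ν ⊴ λ*}`
are those with `¬ ν ⊴ shape σ`. Hence no leading permutation of `I_R(Δ)` has its shape in `Γ`, and
`RG(Γ) ∩ I_R(Δ) = 0`. It follows that the permutations with shape in `Γ` together with the row sums
of the shapes in `Δ` have a determinant over `ℤ` that is divisible by no prime.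
-/

/-! ## Row lengths and conjugation -/

namespace IntegerPartition

open Nat.Partition

variable {n : ℕ}

theorem sum_take_eq_sum_getD (L : List ℕ) (k : ℕ) :
    (L.take k).sum = ∑ i ∈ Finset.range k, L.getD i 0 := by
  induction L generalizing k with
  | nil => simp
  | cons a L ih =>
    cases k with
    | zero => simp
    | succ k => simp [Finset.sum_range_succ', ih, add_comm]

theorem lt_countP_lt_iff_of_pairwise_ge {L : List ℕ} (hL : L.Pairwise (· ≥ ·)) (i j : ℕ) :
    i < L.countP (j < ·) ↔ j < L.getD i 0 := by
  induction L generalizing i with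
  | nil => simp
  | cons a L ih =>
    rw [List.pairwise_cons] at hL
    by_cases hja : j < a
    · cases i with
      | zero => simp [hja]
      | succ i => simpa [hja] using ih hL.2 i
    · have hcount : (a :: L).countP (j < ·) = 0 := by
        simpa [List.countP_eq_zero] using
          ⟨not_lt.1 hja, fun b hb => (hL.1 b hb).trans (not_lt.1 hja)⟩
      have hget : (a :: L).getD i 0 ≤ a := by
        rw [List.getD_eq_getElem?_getD]
        rcases hx : (a :: L)[i]? with _ | b
        · exact Nat.zero_le a
        · rcases List.mem_cons.1 (List.mem_of_getElem? hx) with rfl | hb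
          exacts [le_rfl, hL.1 b hb]
      omega

/-- The length of the `i`-th row of a partition (rows are numbered from `0`); it is `0` beyond the
last row. -/
def rowLen (l : n.Partition) (i : ℕ) : ℕ := l.rows.getD i 0

theorem lt_rowLen_iff (l : n.Partition) (i j : ℕ) :
    j < rowLen l i ↔ i < l.parts.countP (j < ·) := by
  rw [← l.coe_rows, Multiset.coe_countP, rowLen]
  exact (lt_countP_lt_iff_of_pairwise_ge (l.parts.pairwise_sort (· ≥ ·)) i j).symm

theorem rowLen_ofSums {L : List ℕ} (hL : L.Pairwise (· ≥ ·)) (h : (L : Multiset ℕ).sum = n)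
    (i : ℕ) : rowLen (ofSums n L h) i = L.getD i 0 := by
  refine eq_of_forall_lt_iff fun j => ?_
  rw [lt_rowLen_iff, ← lt_countP_lt_iff_of_pairwise_ge hL, ofSums_parts,
    Multiset.countP_filter, ← Multiset.coe_countP]
  have : ∀ x : ℕ, j < x ∧ x ≠ 0 ↔ j < x := by omega
  simp only [this]

theorem rowLen_antitone (l : n.Partition) : Antitone (rowLen l) := fun i i' h => by
  refine le_of_forall_lt fun j hj => ?_
  rw [lt_rowLen_iff] at hj ⊢
  exact h.trans_lt hj

theorem sum_rows (l : n.Partition) : l.rows.sum = n := by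
  rw [← Multiset.sum_coe, coe_rows, l.parts_sum]

theorem length_rows_le (l : n.Partition) : l.rows.length ≤ n :=
  (List.length_le_sum_of_one_le _ l.pos_of_mem_rows).trans (sum_rows l).le

theorem rowLen_eq_zero (l : n.Partition) {i : ℕ} (hi : n ≤ i) : rowLen l i = 0 :=
  List.getD_eq_default _ _ ((length_rows_le l).trans hi)

theorem partialSum_eq_sum (l : n.Partition) (k : ℕ) :
    l.partialSum k = ∑ i ∈ Finset.range k, rowLen l i :=
  sum_take_eq_sum_getD _ _

theorem sum_rowLen (l : n.Partition) : ∑ i ∈ Finset.range n, rowLen l i = n := by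
  rw [← partialSum_eq_sum, partialSum, List.take_of_length_le (length_rows_le l), sum_rows]

theorem partialSum_mono (l : n.Partition) : Monotone l.partialSum := fun i j h => by
  simp only [partialSum_eq_sum]
  exact Finset.sum_le_sum_of_subset (Finset.range_subset_range.2 h)

theorem partialSum_le (l : n.Partition) (k : ℕ) : l.partialSum k ≤ n :=
  ((List.take_sublist k _).sum_le_sum fun _ _ => Nat.zero_le _).trans (sum_rows l).le

/-- The labelling `b` has content `l`: the label `i` occurs `l_i` times. -/
def HasContent (l : n.Partition) (b : Fin n → ℕ) : Prop :=
  ∀ i, (Finset.univ.filter fun v => b v = i).card = rowLen l i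

theorem HasContent.card_filter_lt {l : n.Partition} {b : Fin n → ℕ}
    (hb : HasContent l b) (k : ℕ) :
    (Finset.univ.filter fun v => b v < k).card = l.partialSum k := by
  rw [partialSum_eq_sum, Finset.card_eq_sum_card_fiberwise (f := b) (t := Finset.range k)
    (fun v hv => by simpa using hv)]
  refine Finset.sum_congr rfl fun i hi => ?_
  rw [← hb, Finset.filter_filter]
  congr 1
  ext v
  have := Finset.mem_range.1 hi
  simp only [Finset.mem_filter, Finset.mem_univ, true_and, and_iff_right_iff_imp]
  omega

theorem eq_of_rowLen_eq {l m : n.Partition} (h : ∀ i, rowLen l i = rowLen m i) : l = m :=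
  le_antisymm (fun k => by simp [partialSum_eq_sum, h]) (fun k => by simp [partialSum_eq_sum, h])

theorem rowLen_conj (l : n.Partition) (j : ℕ) :
    rowLen l.conj j = l.parts.countP (j < ·) := by
  have hsorted : ((List.range n).map fun j => (l.parts.filter (j < ·)).card).Pairwise (· ≥ ·) := by
    rw [List.pairwise_map]
    exact List.pairwise_lt_range.imp fun {a b} h =>
      Multiset.card_le_card (Multiset.monotone_filter_right _ fun x hx => h.trans hx)
  rw [Multiset.countP_eq_card_filter]
  refine (rowLen_ofSums hsorted _ j).trans ?_
  by_cases hj : j < n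
  · simp [List.getD, hj]
  · have : l.parts.filter (j < ·) = 0 := by
      rw [Multiset.filter_eq_nil]
      exact fun a ha => not_lt.2 ((le_of_mem_parts ha).trans (not_lt.1 hj))
    simp [this, List.getD, hj]

theorem lt_rowLen_conj (l : n.Partition) (i j : ℕ) : i < rowLen l.conj j ↔ j < rowLen l i := by
  rw [rowLen_conj, lt_rowLen_iff]

theorem conj_conj (l : n.Partition) : l.conj.conj = l :=
  eq_of_rowLen_eq fun i => eq_of_forall_lt_iff fun j => by
    rw [lt_rowLen_conj, lt_rowLen_conj]

theorem rowLen_le (l : n.Partition) (i : ℕ) : rowLen l i ≤ n := by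
  by_contra! h
  have := (lt_rowLen_conj l i n).2 h
  rw [rowLen_eq_zero _ le_rfl] at this
  omega

theorem partialSum_conj (l : n.Partition) (k : ℕ) :
    l.conj.partialSum k = ∑ i ∈ Finset.range n, min k (rowLen l i) := by
  have hcol (j : ℕ) : rowLen l.conj j = ∑ i ∈ Finset.range n, if j < rowLen l i then 1 else 0 := by
    rw [← Finset.card_filter, ← Finset.card_range (rowLen l.conj j)]
    congr 1
    ext i
    have hle := rowLen_le l.conj j
    simp only [Finset.mem_range, Finset.mem_filter, ← lt_rowLen_conj l i j]
    omega
  simp only [partialSum_eq_sum, hcol]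
  rw [Finset.sum_comm]
  refine Finset.sum_congr rfl fun i _ => ?_
  rw [← Finset.card_filter, ← Finset.card_range (min k (rowLen l i))]
  congr 1
  ext j
  simp

theorem partialSum_conj_add_partialSum_le (l : n.Partition) {J : ℕ} (hJ : J ≤ n) (k : ℕ) :
    l.conj.partialSum k + l.partialSum J ≤ J * k + n := by
  have hhead : ∑ i ∈ Finset.range J, min k (rowLen l i) ≤ J * k := by
    simpa using Finset.sum_le_card_nsmul (Finset.range J) _ k fun i _ => min_le_left _ _
  have htail : ∑ i ∈ Finset.Ico J n, min k (rowLen l i) ≤ ∑ i ∈ Finset.Ico J n, rowLen l i :=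
    Finset.sum_le_sum fun i _ => min_le_right _ _
  have hn := sum_rowLen l
  rw [partialSum_conj, partialSum_eq_sum]
  rw [← Finset.sum_range_add_sum_Ico _ hJ] at hn ⊢
  omega

theorem partialSum_conj_add_partialSum_rowLen_conj (l : n.Partition) (k : ℕ) :
    l.conj.partialSum k + l.partialSum (rowLen l.conj k) = rowLen l.conj k * k + n := by
  have hhead : ∑ i ∈ Finset.range (rowLen l.conj k), min k (rowLen l i) = rowLen l.conj k * k := by
    rw [Finset.sum_congr rfl fun i hi =>
      min_eq_left ((lt_rowLen_conj l i k).1 (Finset.mem_range.1 hi)).le]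
    simp
  have htail : ∑ i ∈ Finset.Ico (rowLen l.conj k) n, min k (rowLen l i)
      = ∑ i ∈ Finset.Ico (rowLen l.conj k) n, rowLen l i :=
    Finset.sum_congr rfl fun i hi => min_eq_right <| not_lt.1 fun h =>
      (Finset.mem_Ico.1 hi).1.not_gt ((lt_rowLen_conj l i k).2 h)
  have hn := sum_rowLen l
  rw [partialSum_conj, partialSum_eq_sum]
  rw [← Finset.sum_range_add_sum_Ico _ (rowLen_le l.conj k)] at hn ⊢
  omega

theorem conj_antitone : Antitone (conj : n.Partition → n.Partition) := fun l m h k => by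
  have hl := partialSum_conj_add_partialSum_rowLen_conj l k
  have hm := partialSum_conj_add_partialSum_le m (rowLen_le l.conj k) k
  have hlm := h (rowLen l.conj k)
  omega

theorem mem_compl_image_conj {Γ : Finset n.Partition} {l : n.Partition} :
    l ∈ Finset.univ \ Γ.image conj ↔ l.conj ∉ Γ := by
  have : (∃ m ∈ Γ, m.conj = l) ↔ l.conj ∈ Γ :=
    ⟨fun ⟨m, hm, hml⟩ => hml ▸ (conj_conj m).symm ▸ hm, fun h => ⟨_, h, conj_conj l⟩⟩
  simp [this]

theorem isUpperSet_compl_image_conj {Γ : Finset n.Partition}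
    (hΓ : IsUpperSet (Γ : Set n.Partition)) :
    IsUpperSet ((Finset.univ \ Γ.image conj : Finset n.Partition) : Set n.Partition) := by
  intro l m hlm hl
  rw [Finset.mem_coe, mem_compl_image_conj] at hl ⊢
  exact fun hm => hl (hΓ (conj_antitone hlm) hm)

theorem mem_diagram (l : n.Partition) (c : ℕ × ℕ) :
    c ∈ l.diagram.cells ↔ c.2 < rowLen l c.1 := by
  rw [YoungDiagram.mem_cells, diagram, YoungDiagram.mem_ofRowLens, rowLen]
  by_cases hc : c.1 < l.rows.length
  · simp [List.getD, hc]
  · simp [List.getD, hc]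

/-- Transposition as a bijection between the cells of the conjugate partition and the cells. -/
def conjCells (l : n.Partition) : l.conj.diagram.cells ≃ l.diagram.cells :=
  (Equiv.prodComm ℕ ℕ).subtypeEquiv fun c => by
    rw [mem_diagram, mem_diagram, lt_rowLen_conj]
    rfl

theorem numStandard_conj (l : n.Partition) : l.conj.numStandard = l.numStandard := by
  refine Nat.card_congr (Equiv.subtypeEquiv ((conjCells l).equivCongr (Equiv.refl _)) ?_)
  refine fun T => ⟨fun ⟨hrow, hcol⟩ => ⟨fun c d => ?_, fun c d => ?_⟩,
    fun ⟨hrow, hcol⟩ => ⟨fun c d h h' => ?_, fun c d h h' => ?_⟩⟩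
  · exact hcol ((conjCells l).symm c) ((conjCells l).symm d)
  · exact hrow ((conjCells l).symm c) ((conjCells l).symm d)
  · simpa using hcol (conjCells l c) (conjCells l d) h h'
  · simpa using hrow (conjCells l c) (conjCells l d) h h'

end IntegerPartition

/-! ## Yamanouchi labellings and standard tableaux -/

namespace IntegerPartition

variable {n : ℕ}

/-- The number of elements smaller than `m` with label `i`. -/
def prefixCount (r : Fin n → ℕ) (m i : ℕ) : ℕ :=
  (Finset.univ.filter fun u : Fin n => (u : ℕ) < m ∧ r u = i).card

/-- The Yamanouchi (lattice word) labellings with `l_i` labels `i`: the row index functions of the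
standard tableaux of shape `l`. -/
structure IsYamanouchi (l : n.Partition) (r : Fin n → ℕ) : Prop where
  antitone_prefixCount {m : ℕ} (hm : m ≤ n) : Antitone (prefixCount r m)
  prefixCount_eq_rowLen (i : ℕ) : prefixCount r n i = rowLen l i

theorem prefixCount_mono (r : Fin n → ℕ) (i : ℕ) : Monotone fun m => prefixCount r m i :=
  fun _ _ h => Finset.card_le_card fun _ hu => by
    simp only [Finset.mem_filter] at hu ⊢
    exact ⟨hu.1, hu.2.1.trans_le h, hu.2.2⟩

theorem prefixCount_succ (r : Fin n → ℕ) (v : Fin n) (i : ℕ) :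
    prefixCount r (v + 1) i = prefixCount r v i + if r v = i then 1 else 0 := by
  have hsplit (u : Fin n) : (u : ℕ) < v + 1 ∧ r u = i ↔
      ((u : ℕ) < v ∧ r u = i) ∨ (u = v ∧ r v = i) := by
    rw [Nat.lt_succ_iff_lt_or_eq, or_and_right]
    refine or_congr Iff.rfl ⟨fun ⟨h, h'⟩ => ?_, fun ⟨h, h'⟩ => ⟨congrArg _ h, h ▸ h'⟩⟩
    obtain rfl := Fin.ext h
    exact ⟨rfl, h'⟩
  simp only [prefixCount, hsplit]
  rw [Finset.filter_or, Finset.card_union_of_disjoint]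
  · congr 1
    split_ifs with h <;> simp [h, Finset.filter_eq']
  · rw [Finset.disjoint_filter]
    rintro u - ⟨hu, -⟩ ⟨rfl, -⟩
    exact lt_irrefl _ hu

theorem prefixCount_lt_of_lt (r : Fin n → ℕ) {v : Fin n} {m : ℕ} (hvm : (v : ℕ) < m) :
    prefixCount r v (r v) < prefixCount r m (r v) :=
  calc prefixCount r v (r v) < prefixCount r (v + 1) (r v) := by simp [prefixCount_succ]
    _ ≤ prefixCount r m (r v) := prefixCount_mono r (r v) hvm

/-- The cell of `v` in the tableau whose rows are the fibres of `r`. -/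
def cell (r : Fin n → ℕ) (v : Fin n) : ℕ × ℕ := (r v, prefixCount r v (r v))

theorem cell_injective (r : Fin n → ℕ) : Function.Injective (cell r) := by
  have hne {u v : Fin n} (huv : u < v) : cell r u ≠ cell r v := fun h => by
    have hlt := prefixCount_lt_of_lt r (Fin.lt_def.1 huv)
    obtain ⟨hrow, hcol⟩ := Prod.mk.inj h
    rw [← hrow] at hcol
    omega
  intro u v h
  rcases lt_trichotomy u v with huv | huv | huv
  exacts [(hne huv h).elim, huv, (hne huv h.symm).elim]

theorem card_cells (l : n.Partition) : l.diagram.cells.card = n := by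
  have hfib (i : ℕ) : (l.diagram.cells.filter fun c => c.1 = i).card = rowLen l i := by
    have : (l.diagram.cells.filter fun c => c.1 = i)
        = (Finset.range (rowLen l i)).image (Prod.mk i) := by
      ext ⟨a, b⟩
      simp only [Finset.mem_filter, mem_diagram, Finset.mem_image, Finset.mem_range, Prod.mk.injEq]
      exact ⟨fun ⟨h, h'⟩ => ⟨b, h' ▸ h, h'.symm, rfl⟩,
        fun ⟨_, h, h', h''⟩ => ⟨h' ▸ h'' ▸ h, h'.symm⟩⟩
    rw [this, Finset.card_image_of_injective _ (Prod.mk_right_injective i), Finset.card_range]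
  have hmaps : ∀ c ∈ l.diagram.cells, c.1 ∈ Finset.range n := fun c hc => by
    by_contra hcn
    rw [mem_diagram, rowLen_eq_zero l (by simpa using hcn)] at hc
    exact Nat.not_lt_zero _ hc
  rw [Finset.card_eq_sum_card_fiberwise hmaps]
  simp only [hfib, sum_rowLen]

instance (l : n.Partition) : Finite l.StandardTableau :=
  inferInstanceAs (Finite {_T : l.diagram.cells ≃ Fin n // _})

namespace IsYamanouchi

variable {l : n.Partition} {r : Fin n → ℕ}

theorem cell_mem (hr : IsYamanouchi l r) (v : Fin n) : cell r v ∈ l.diagram.cells := by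
  rw [mem_diagram, ← hr.prefixCount_eq_rowLen]
  exact prefixCount_lt_of_lt r v.isLt

/-- The bijection between `Fin n` and the cells that sends `v` to its cell. -/
noncomputable def cellEquiv (hr : IsYamanouchi l r) : Fin n ≃ l.diagram.cells :=
  Equiv.ofBijective (fun v => ⟨cell r v, hr.cell_mem v⟩) <|
    (Fintype.bijective_iff_injective_and_card _).2
      ⟨fun _ _ h => cell_injective r (Subtype.ext_iff.1 h), by simp [card_cells]⟩

theorem lt_of_row_eq {u v : Fin n} (hrow : r u = r v)
    (hcol : prefixCount r u (r u) < prefixCount r v (r v)) : u < v := by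
  by_contra! h
  rw [← hrow] at hcol
  exact hcol.not_ge (prefixCount_mono r (r u) (Fin.le_def.1 h))

theorem lt_of_col_eq (hr : IsYamanouchi l r) {u v : Fin n} (hrow : r u < r v)
    (hcol : prefixCount r u (r u) = prefixCount r v (r v)) : u < v := by
  by_contra! h
  have hvu : v < u := lt_of_le_of_ne h (by rintro rfl; exact lt_irrefl _ hrow)
  exact lt_irrefl _ <|
    calc prefixCount r v (r v)
          < prefixCount r (v + 1) (r v) := prefixCount_lt_of_lt r (lt_add_one _)
      _ ≤ prefixCount r (v + 1) (r u) := hr.antitone_prefixCount v.isLt hrow.le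
      _ ≤ prefixCount r u (r u) := prefixCount_mono r (r u) hvu
      _ = prefixCount r v (r v) := hcol

/-- The standard tableau with row index function `r`. -/
noncomputable def tableau (hr : IsYamanouchi l r) : l.StandardTableau :=
  ⟨hr.cellEquiv.symm, by
    constructor <;> intro c d
    all_goals
      obtain ⟨u, rfl⟩ := hr.cellEquiv.surjective c
      obtain ⟨v, rfl⟩ := hr.cellEquiv.surjective d
      simp only [Equiv.symm_apply_apply]
    · exact lt_of_row_eq
    · exact fun h h' => hr.lt_of_col_eq h' h⟩

theorem tableau_injective {r' : Fin n → ℕ} (hr : IsYamanouchi l r) (hr' : IsYamanouchi l r')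
    (h : hr.tableau = hr'.tableau) : r = r' := by
  have hcell : hr.cellEquiv = hr'.cellEquiv :=
    Equiv.symm_bijective.injective (Subtype.ext_iff.1 h)
  exact funext fun v => congrArg (fun e : Fin n ≃ l.diagram.cells => (e v).1.1) hcell

end IsYamanouchi

end IntegerPartition

/-! ## Row insertion -/

namespace RobinsonSchensted

theorem rowInsert_eq_of_snd_eq_none {x : ℕ} {r : List ℕ} (h : (rowInsert x r).2 = none) :
    (rowInsert x r).1 = r ++ [x] ∧ ∀ a ∈ r, a ≤ x := by
  induction r with
  | nil => simp [rowInsert]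
  | cons a as ih => grind [rowInsert]

theorem exists_append_of_rowInsert_snd_eq_some {x y : ℕ} {r : List ℕ}
    (h : (rowInsert x r).2 = some y) :
    ∃ u v, r = u ++ y :: v ∧ (rowInsert x r).1 = u ++ x :: v ∧ (∀ a ∈ u, a ≤ x) ∧ x < y := by
  induction r with
  | nil => simp [rowInsert] at h
  | cons a as ih =>
    by_cases hx : x < a
    · simp only [rowInsert, hx, if_true, Option.some.injEq] at h ⊢
      subst h
      exact ⟨[], as, rfl, rfl, by simp, hx⟩
    · simp only [rowInsert, hx, if_false] at h ⊢
      obtain ⟨u, v, hr, hr', hu, hxy⟩ := ih h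
      exact ⟨a :: u, v, by simp [hr], by simp [hr'], by simpa [not_lt.1 hx] using hu, hxy⟩

theorem rowInsert_ne_nil (x : ℕ) (r : List ℕ) : (rowInsert x r).1 ≠ [] := by
  cases r with
  | nil => simp [rowInsert]
  | cons a as => rw [rowInsert]; split_ifs <;> simp

theorem pairwise_rowInsert {r : List ℕ} (hr : r.Pairwise (· ≤ ·)) (x : ℕ) :
    (rowInsert x r).1.Pairwise (· ≤ ·) := by
  cases hx : (rowInsert x r).2 with
  | none =>
    obtain ⟨heq, hle⟩ := rowInsert_eq_of_snd_eq_none hx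
    rw [heq]
    simpa [List.pairwise_append] using ⟨hr, hle⟩
  | some y =>
    obtain ⟨u, v, rfl, heq, hu, hxy⟩ := exists_append_of_rowInsert_snd_eq_some hx
    rw [heq]
    simp only [List.pairwise_append, List.pairwise_cons] at hr ⊢
    grind

theorem rowInsert_perm (x : ℕ) (r : List ℕ) :
    ((rowInsert x r).1 ++ (rowInsert x r).2.toList).Perm (x :: r) := by
  cases hx : (rowInsert x r).2 with
  | none => simp [(rowInsert_eq_of_snd_eq_none hx).1]
  | some y =>
    obtain ⟨u, v, rfl, heq, -, -⟩ := exists_append_of_rowInsert_snd_eq_some hx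
    rw [heq]
    refine (List.perm_append_singleton y _).trans ?_
    exact (List.perm_middle.cons y).trans
      ((List.Perm.swap x y _).trans (List.perm_middle.symm.cons x))

theorem rowInsert_injective {x x' y : ℕ} {r r' : List ℕ} (hr : r.Pairwise (· ≤ ·))
    (hr' : r'.Pairwise (· ≤ ·)) (hy : (rowInsert x r).2 = some y)
    (hy' : (rowInsert x' r').2 = some y) (h : (rowInsert x r).1 = (rowInsert x' r').1) :
    x = x' ∧ r = r' := by
  obtain ⟨u, v, rfl, heq, hu, hxy⟩ := exists_append_of_rowInsert_snd_eq_some hy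
  obtain ⟨u', v', rfl, heq', hu', hxy'⟩ := exists_append_of_rowInsert_snd_eq_some hy'
  rw [heq, heq'] at h
  have hfilter {u v : List ℕ} {x : ℕ} (hr : (u ++ y :: v).Pairwise (· ≤ ·)) (hu : ∀ a ∈ u, a ≤ x)
      (hxy : x < y) : (u ++ x :: v).filter (· < y) = u ++ [x] := by
    simp only [List.pairwise_append, List.pairwise_cons] at hr
    rw [List.filter_append, List.filter_cons_of_pos (by simpa using hxy),
      List.filter_eq_self.2 fun a ha => by simpa using (hu a ha).trans_lt hxy,
      List.filter_eq_nil_iff.2 fun a ha => by simpa using hr.2.1.1 a ha]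
  have hsmall := congrArg (List.filter (· < y)) h
  rw [hfilter hr hu hxy, hfilter hr' hu' hxy'] at hsmall
  obtain ⟨rfl, hxx'⟩ := List.append_inj' hsmall rfl
  obtain ⟨rfl, rfl⟩ := List.cons.inj (List.append_cancel_left h)
  exact ⟨rfl, rfl⟩

/-! ## Tableaux -/

/-- The row `s` may stand below the row `r`: for sorted rows this says that `s` is not longer than
`r` and that each entry of `s` is larger than the entry of `r` above it. -/
def ColLT (r s : List ℕ) : Prop := ∀ m, s.countP (· ≤ m) ≤ r.countP (· < m)

/-- Semistandard tableaux as lists of nonempty rows. -/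
def IsTableau : List (List ℕ) → Prop
  | [] => True
  | r :: rs => r ≠ [] ∧ r.Pairwise (· ≤ ·) ∧ ColLT r (rs.headD []) ∧ IsTableau rs

theorem colLT_nil (r : List ℕ) : ColLT r [] := fun m => by simp

theorem ColLT.countP_lt_le {r s : List ℕ} (h : ColLT r s) (m : ℕ) :
    s.countP (· < m) ≤ r.countP (· < m) :=
  (List.countP_mono_left fun a _ ha => by simp only [decide_eq_true_eq] at ha ⊢; omega).trans (h m)

theorem ColLT.length_le {r s : List ℕ} (h : ColLT r s) : s.length ≤ r.length := by
  have hs : s.countP (· ≤ s.sum) = s.length :=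
    List.countP_eq_length.2 fun a ha => by simpa using List.le_sum_of_mem ha
  exact hs ▸ (h s.sum).trans List.countP_le_length

theorem countP_rowInsert (p : ℕ → Bool) (x : ℕ) (r : List ℕ) :
    (rowInsert x r).1.countP p + (rowInsert x r).2.toList.countP p
      = r.countP p + if p x then 1 else 0 := by
  rw [← List.countP_append, (rowInsert_perm x r).countP_eq, List.countP_cons]

theorem ColLT.rowInsert_left {r s : List ℕ} (h : ColLT r s) (x : ℕ) :
    ColLT (rowInsert x r).1 s := fun m => (h m).trans <| by
  have hcount := countP_rowInsert (· < m) x r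
  cases hx : (rowInsert x r).2 with
  | none =>
    rw [hx] at hcount
    simp at hcount
    omega
  | some y =>
    obtain ⟨-, -, -, -, -, hxy⟩ := exists_append_of_rowInsert_snd_eq_some hx
    simp only [hx, Option.toList_some, List.countP_singleton, decide_eq_true_eq] at hcount
    split_ifs at hcount <;> omega

theorem countP_lt_lt_countP_lt {r : List ℕ} {y m : ℕ} (hy : y ∈ r) (hym : y < m) :
    r.countP (· < y) < r.countP (· < m) := by
  obtain ⟨u, v, rfl⟩ := List.append_of_mem hy
  have hmono (w : List ℕ) : w.countP (· < y) ≤ w.countP (· < m) :=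
    List.countP_mono_left fun a _ ha => by simpa using (of_decide_eq_true ha).trans hym
  have hu := hmono u
  have hv := hmono v
  simp only [List.countP_append, List.countP_cons, lt_irrefl, hym, decide_true, decide_false,
    if_true, Bool.false_eq_true, if_false]
  omega

theorem countP_le_le_countP_le_of_rowInsert {s : List ℕ} (hs : s.Pairwise (· ≤ ·)) {y m : ℕ}
    (h : ∀ z, (rowInsert y s).2 = some z → m < z) : s.countP (· ≤ m) ≤ s.countP (· ≤ y) := by
  refine List.countP_mono_left fun a ha ham => ?_
  simp only [decide_eq_true_eq] at ham ⊢
  cases hz : (rowInsert y s).2 with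
  | none => exact (rowInsert_eq_of_snd_eq_none hz).2 a ha
  | some z =>
    have hmz := h z hz
    obtain ⟨u, v, rfl, -, hu, -⟩ := exists_append_of_rowInsert_snd_eq_some hz
    simp only [List.pairwise_append, List.pairwise_cons] at hs
    rcases List.mem_append.1 ha with hau | hav
    · exact hu a hau
    · rcases List.mem_cons.1 hav with rfl | hav
      · omega
      · have := hs.2.1.1 a hav
        omega

theorem ColLT.rowInsert_bump {r s : List ℕ} (hs : s.Pairwise (· ≤ ·)) {x y : ℕ} (h : ColLT r s)
    (hy : (rowInsert x r).2 = some y) : ColLT (rowInsert x r).1 (rowInsert y s).1 := by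
  intro m
  obtain ⟨u, v, hr, -, -, hxy⟩ := exists_append_of_rowInsert_snd_eq_some hy
  have hm := h m
  have hcr := countP_rowInsert (· < m) x r
  have hcs := countP_rowInsert (· ≤ m) y s
  simp only [hy, Option.toList_some, List.countP_singleton, decide_eq_true_eq] at hcr hcs
  by_cases hym : y < m
  · by_cases hz : ∀ z, (rowInsert y s).2 = some z → m < z
    · have hlow := countP_le_le_countP_le_of_rowInsert hs hz
      have hgap := countP_lt_lt_countP_lt (m := m) (by simp [hr] : y ∈ r) hym
      have := h y
      split_ifs at hcr hcs <;> omega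
    · push Not at hz
      obtain ⟨z, hz, hzm⟩ := hz
      simp only [hz, Option.toList_some, List.countP_singleton, decide_eq_true_eq, hzm,
        if_true] at hcs
      split_ifs at hcr hcs <;> omega
  · split_ifs at hcr hcs <;> omega

theorem headD_tableauInsert (x : ℕ) (T : List (List ℕ)) :
    (tableauInsert x T).headD [] = (rowInsert x (T.headD [])).1 := by
  cases T with
  | nil => rfl
  | cons r rs =>
    rw [tableauInsert]
    split <;> rfl

theorem IsTableau.pairwise_headD {T : List (List ℕ)} (hT : IsTableau T) :
    (T.headD []).Pairwise (· ≤ ·) := by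
  cases T with
  | nil => exact List.Pairwise.nil
  | cons r rs => exact hT.2.1

theorem IsTableau.tableauInsert {T : List (List ℕ)} (hT : IsTableau T) (x : ℕ) :
    IsTableau (tableauInsert x T) := by
  induction T generalizing x with
  | nil => exact ⟨by simp, by simp, colLT_nil _, trivial⟩
  | cons r rs ih =>
    obtain ⟨-, hsorted, hcol, hrs⟩ := hT
    rw [RobinsonSchensted.tableauInsert]
    split
    case h_1 =>
      exact ⟨rowInsert_ne_nil _ _, pairwise_rowInsert hsorted _, hcol.rowInsert_left x, hrs⟩
    case h_2 y hy =>
      refine ⟨rowInsert_ne_nil _ _, pairwise_rowInsert hsorted _, ?_, ih hrs y⟩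
      rw [headD_tableauInsert]
      exact hcol.rowInsert_bump hrs.pairwise_headD hy

theorem IsTableau.colLT_getD {T : List (List ℕ)} (hT : IsTableau T) (i : ℕ) :
    ColLT (T.getD i []) (T.getD (i + 1) []) := by
  induction T generalizing i with
  | nil => simpa using colLT_nil []
  | cons r rs ih =>
    cases i with
    | zero => cases rs <;> exact hT.2.2.1
    | succ i => exact ih hT.2.2.2 i

theorem IsTableau.pairwise_getD {T : List (List ℕ)} (hT : IsTableau T) (i : ℕ) :
    (T.getD i []).Pairwise (· ≤ ·) := by
  induction T generalizing i with
  | nil => simp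
  | cons r rs ih =>
    cases i with
    | zero => exact hT.pairwise_headD
    | succ i => exact ih hT.2.2.2 i

theorem IsTableau.antitone_countP_lt {T : List (List ℕ)} (hT : IsTableau T) (m : ℕ) :
    Antitone fun i => (T.getD i []).countP (· < m) :=
  antitone_nat_of_succ_le fun i => (hT.colLT_getD i).countP_lt_le m

theorem IsTableau.antitone_length {T : List (List ℕ)} (hT : IsTableau T) :
    Antitone fun i => (T.getD i []).length :=
  antitone_nat_of_succ_le fun i => (hT.colLT_getD i).length_le

theorem flatten_tableauInsert_perm (x : ℕ) (T : List (List ℕ)) :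
    (tableauInsert x T).flatten.Perm (x :: T.flatten) := by
  induction T generalizing x with
  | nil => simp [tableauInsert]
  | cons r rs ih =>
    have hperm := (rowInsert_perm x r).append_right rs.flatten
    rw [tableauInsert]
    cases hx : (rowInsert x r).2 with
    | none => simpa [hx] using hperm
    | some y =>
      rw [hx] at hperm
      simpa using ((ih y).append_left (rowInsert x r).1).trans (by simpa using hperm)

/-- The index of the row that gets longer when `x` is inserted into a tableau. -/
def insertRow (x : ℕ) : List (List ℕ) → ℕ
  | [] => 0
  | r :: rs =>
    match (rowInsert x r).2 with
    | none => 0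
    | some y => insertRow y rs + 1

theorem length_getD_tableauInsert (x : ℕ) (T : List (List ℕ)) (i : ℕ) :
    ((tableauInsert x T).getD i []).length
      = (T.getD i []).length + if insertRow x T = i then 1 else 0 := by
  induction T generalizing x i with
  | nil => cases i <;> simp [tableauInsert, insertRow]
  | cons r rs ih =>
    have hlen := length_rowInsert x r
    rw [tableauInsert, insertRow]
    cases hx : (rowInsert x r).2 with
    | none =>
      rw [hx] at hlen
      cases i with
      | zero => simpa using hlen
      | succ i => simp
    | some y =>
      rw [hx] at hlen
      cases i with
      | zero => simpa using hlen
      | succ i => simpa using ih y i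

theorem insertRow_eq_zero_iff (x : ℕ) (T : List (List ℕ)) :
    insertRow x T = 0 ↔ (rowInsert x (T.headD [])).2 = none := by
  cases T with
  | nil => simp [insertRow, rowInsert]
  | cons r rs => rw [insertRow, List.headD_cons]; split <;> simp [*]

theorem tableauInsert_eq_of_insertRow_eq_zero {x : ℕ} {T : List (List ℕ)}
    (h : insertRow x T = 0) : tableauInsert x T = (T.headD [] ++ [x]) :: T.tail := by
  rw [insertRow_eq_zero_iff] at h
  have := (rowInsert_eq_of_snd_eq_none h).1
  cases T with
  | nil => rfl
  | cons r rs =>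
    rw [List.headD_cons] at h this
    simp [tableauInsert, h, this]

theorem exists_cons_of_insertRow_eq_succ {x i : ℕ} {T : List (List ℕ)}
    (h : insertRow x T = i + 1) : ∃ r rs y, T = r :: rs ∧ (rowInsert x r).2 = some y ∧
      insertRow y rs = i ∧ tableauInsert x T = (rowInsert x r).1 :: tableauInsert y rs := by
  cases T with
  | nil => simp [insertRow] at h
  | cons r rs =>
    rw [insertRow] at h
    cases hx : (rowInsert x r).2 with
    | none => simp [hx] at h
    | some y => exact ⟨r, rs, y, rfl, hx, by simpa [hx] using h, by simp [tableauInsert, hx]⟩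

theorem IsTableau.eq_of_headD_tail {T T' : List (List ℕ)} (hT : IsTableau T) (hT' : IsTableau T')
    (hhead : T.headD [] = T'.headD []) (htail : T.tail = T'.tail) : T = T' := by
  cases T <;> cases T' <;> simp_all [IsTableau]

theorem tableauInsert_injective {x x' : ℕ} {T T' : List (List ℕ)} (hT : IsTableau T)
    (hT' : IsTableau T') (hrow : insertRow x T = insertRow x' T')
    (h : tableauInsert x T = tableauInsert x' T') : x = x' ∧ T = T' := by
  induction hi : insertRow x T generalizing x x' T T' with
  | zero =>
    rw [tableauInsert_eq_of_insertRow_eq_zero hi,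
      tableauInsert_eq_of_insertRow_eq_zero (hrow.symm.trans hi)] at h
    obtain ⟨hhead, htail⟩ := List.cons.inj h
    obtain ⟨hhead, hx⟩ := List.append_inj' hhead rfl
    exact ⟨List.singleton_injective hx, hT.eq_of_headD_tail hT' hhead htail⟩
  | succ i ih =>
    obtain ⟨r, rs, y, rfl, hy, hi', heq⟩ := exists_cons_of_insertRow_eq_succ hi
    obtain ⟨r', rs', y', rfl, hy', hi'', heq'⟩ :=
      exists_cons_of_insertRow_eq_succ (hrow.symm.trans hi)
    rw [heq, heq'] at h
    obtain ⟨hhead, htail⟩ := List.cons.inj h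
    obtain ⟨rfl, rfl⟩ := ih hT.2.2.2 hT'.2.2.2 (hi'.trans hi''.symm) htail hi'
    obtain ⟨rfl, rfl⟩ := rowInsert_injective hT.2.1 hT'.2.1 hy hy' hhead
    exact ⟨rfl, rfl⟩

end RobinsonSchensted

/-! ## The number of permutations of a given shape -/

namespace RobinsonSchensted

open IntegerPartition

theorem isTableau_insertionTableau (w : List ℕ) : IsTableau (insertionTableau w) := by
  induction w using List.reverseRecOn with
  | nil => trivial
  | append_singleton w x ih =>
    simpa [insertionTableau] using ih.tableauInsert x

theorem flatten_insertionTableau_perm (w : List ℕ) : (insertionTableau w).flatten.Perm w := by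
  induction w using List.reverseRecOn with
  | nil => rfl
  | append_singleton w x ih =>
    simpa [insertionTableau] using (flatten_tableauInsert_perm x _).trans
      ((ih.cons x).trans (List.perm_append_singleton x w).symm)

/-- The index of the first row of `T` that contains `v`. -/
def rowIndex (T : List (List ℕ)) (v : ℕ) : ℕ := T.findIdx (v ∈ ·)

theorem mem_flatten_of_mem_getD {T : List (List ℕ)} {v i : ℕ} (h : v ∈ T.getD i []) :
    v ∈ T.flatten := by
  rw [List.getD_eq_getElem?_getD] at h
  rcases hq : T[i]? with _ | q
  · simp [hq] at h
  · exact List.mem_flatten.2 ⟨q, List.mem_of_getElem? hq, by simpa [hq] using h⟩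

theorem nodup_getD {T : List (List ℕ)} (hT : T.flatten.Nodup) (i : ℕ) : (T.getD i []).Nodup := by
  rw [List.getD_eq_getElem?_getD]
  rcases hq : T[i]? with _ | q
  · simp
  · exact (List.nodup_flatten.1 hT).1 q (List.mem_of_getElem? hq)

theorem rowIndex_eq_iff {T : List (List ℕ)} (hT : T.flatten.Nodup) {v : ℕ} (hv : v ∈ T.flatten)
    (i : ℕ) : rowIndex T v = i ↔ v ∈ T.getD i [] := by
  induction T generalizing i with
  | nil => simp at hv
  | cons r rs ih =>
    rw [List.flatten_cons, List.nodup_append'] at hT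
    rw [List.flatten_cons, List.mem_append] at hv
    by_cases hvr : v ∈ r
    · have hvrs (i : ℕ) : v ∉ rs.getD i [] := fun h => hT.2.2 hvr (mem_flatten_of_mem_getD h)
      cases i with
      | zero => simp [rowIndex, List.findIdx_cons, hvr]
      | succ i => simpa [rowIndex, List.findIdx_cons, hvr] using hvrs i
    · have hvrs := hv.resolve_left hvr
      cases i with
      | zero => simp [rowIndex, List.findIdx_cons, hvr]
      | succ i => simpa [rowIndex, List.findIdx_cons, hvr] using ih hT.2.1 hvrs i

theorem IsTableau.ext_getD {T T' : List (List ℕ)} (hT : IsTableau T) (hT' : IsTableau T')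
    (h : ∀ i, T.getD i [] = T'.getD i []) : T = T' := by
  induction T generalizing T' with
  | nil =>
    cases T' with
    | nil => rfl
    | cons r' rs' => exact (hT'.1 (h 0).symm).elim
  | cons r rs ih =>
    cases T' with
    | nil => exact (hT.1 (h 0)).elim
    | cons r' rs' => rw [show r = r' from h 0, ih hT.2.2.2 hT'.2.2.2 fun i => h (i + 1)]

theorem IsTableau.eq_of_rowIndex_eq {T T' : List (List ℕ)} (hT : IsTableau T) (hT' : IsTableau T')
    (hnodup : T.flatten.Nodup) (hperm : T.flatten.Perm T'.flatten)
    (h : ∀ v ∈ T.flatten, rowIndex T v = rowIndex T' v) : T = T' := by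
  have hnodup' := hperm.nodup_iff.1 hnodup
  refine hT.ext_getD hT' fun i => ?_
  refine List.Perm.eq_of_pairwise (fun a b _ _ => le_antisymm) (hT.pairwise_getD i)
    (hT'.pairwise_getD i) ?_
  refine (List.perm_ext_iff_of_nodup (nodup_getD hnodup i) (nodup_getD hnodup' i)).2 fun v => ?_
  by_cases hv : v ∈ T.flatten
  · rw [← rowIndex_eq_iff hnodup hv, ← rowIndex_eq_iff hnodup' (hperm.mem_iff.1 hv), h v hv]
  · exact iff_of_false (fun h => hv (mem_flatten_of_mem_getD h))
      fun h => hv (hperm.mem_iff.2 (mem_flatten_of_mem_getD h))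

variable {n : ℕ} (σ : Equiv.Perm (Fin n))

theorem countP_eq_card_filter {L : List ℕ} (hL : L.Nodup) (hlt : ∀ a ∈ L, a < n) (p : ℕ → Bool) :
    L.countP p = (Finset.univ.filter fun v : Fin n => (v : ℕ) ∈ L ∧ p v).card := by
  rw [List.countP_eq_length_filter, ← List.toFinset_card_of_nodup (hL.filter p),
    ← Finset.card_map Fin.valEmbedding]
  congr 1
  ext a
  simp only [Finset.mem_map, Finset.mem_filter, Finset.mem_univ, true_and,
    Fin.valEmbedding_apply, List.mem_toFinset, List.mem_filter]
  exact ⟨fun ha => ⟨⟨a, hlt a ha.1⟩, ha, rfl⟩, fun ⟨_, hv, hva⟩ => hva ▸ hv⟩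

theorem nodup_word : (word σ).Nodup :=
  List.nodup_ofFn.2 (Fin.val_injective.comp σ.injective)

theorem mem_word {a : ℕ} : a ∈ word σ ↔ a < n := by
  rw [word, List.mem_ofFn]
  exact ⟨fun ⟨i, hi⟩ => hi ▸ (σ i).isLt, fun h => ⟨σ.symm ⟨a, h⟩, by simp⟩⟩

theorem lt_of_mem_getD_insertionTableau {a i : ℕ}
    (h : a ∈ (insertionTableau (word σ)).getD i []) : a < n :=
  (mem_word σ).1 ((flatten_insertionTableau_perm _).mem_iff.1 (mem_flatten_of_mem_getD h))

/-- The row of the insertion tableau of `σ` that contains `v`. -/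
def insertionRow (v : Fin n) : ℕ := rowIndex (insertionTableau (word σ)) v

/-- The row of the recording tableau of `σ` that contains `j`: the row that gets longer when the
`j`-th letter is inserted. -/
def recordingRow (j : Fin n) : ℕ := insertRow (σ j) (insertionTableau ((word σ).take j))

theorem insertionTableau_take_succ (j : Fin n) :
    insertionTableau ((word σ).take (j + 1))
      = tableauInsert (σ j) (insertionTableau ((word σ).take j)) := by
  have htake : (word σ).take (j + 1) = (word σ).take j ++ [(σ j : ℕ)] := by
    rw [List.take_add_one]
    simp [word]
  simp [htake, insertionTableau]

theorem length_getD_insertionTableau_take {m : ℕ} (hm : m ≤ n) (i : ℕ) :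
    ((insertionTableau ((word σ).take m)).getD i []).length
      = prefixCount (recordingRow σ) m i := by
  induction m with
  | zero => simp [insertionTableau, prefixCount]
  | succ m ih =>
    have hstep := insertionTableau_take_succ σ ⟨m, hm⟩
    have hcount := prefixCount_succ (recordingRow σ) ⟨m, hm⟩ i
    simp only at hstep hcount
    rw [hstep, hcount, length_getD_tableauInsert, ih (Nat.le_of_succ_le hm)]
    rfl

theorem take_word : (word σ).take n = word σ := List.take_of_length_le (by simp [word])

theorem rowLen_shape (i : ℕ) :
    rowLen (shape σ) i = ((insertionTableau (word σ)).getD i []).length := by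
  have hsorted : ((insertionTableau (word σ)).map List.length).Pairwise (· ≥ ·) := by
    rw [List.pairwise_iff_getElem]
    intro i j hi hj hij
    simp only [List.length_map] at hi hj
    simpa [List.getD, hi, hj] using
      (isTableau_insertionTableau (word σ)).antitone_length hij.le
  refine (rowLen_ofSums hsorted _ i).trans ?_
  exact List.getD_map (d := []) ..

theorem isYamanouchi_recordingRow : IsYamanouchi (shape σ) (recordingRow σ) where
  antitone_prefixCount hm i j hij := by
    simpa only [← length_getD_insertionTableau_take σ hm] using
      (isTableau_insertionTableau _).antitone_length hij
  prefixCount_eq_rowLen i := by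
    rw [← length_getD_insertionTableau_take σ le_rfl, take_word, rowLen_shape]

theorem insertionRow_eq_iff (v : Fin n) (i : ℕ) :
    insertionRow σ v = i ↔ (v : ℕ) ∈ (insertionTableau (word σ)).getD i [] := by
  have hperm := flatten_insertionTableau_perm (word σ)
  exact rowIndex_eq_iff (hperm.nodup_iff.2 (nodup_word σ))
    (hperm.mem_iff.2 ((mem_word σ).2 v.isLt)) i

theorem prefixCount_insertionRow (m i : ℕ) :
    prefixCount (insertionRow σ) m i
      = ((insertionTableau (word σ)).getD i []).countP (· < m) := by
  have hnodup := nodup_getD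
    ((flatten_insertionTableau_perm _).nodup_iff.2 (nodup_word σ)) i
  rw [countP_eq_card_filter hnodup fun a => lt_of_mem_getD_insertionTableau σ, prefixCount]
  simp only [insertionRow_eq_iff, decide_eq_true_eq, and_comm]

theorem isYamanouchi_insertionRow : IsYamanouchi (shape σ) (insertionRow σ) where
  antitone_prefixCount _ i j hij := by
    simpa only [prefixCount_insertionRow] using
      (isTableau_insertionTableau _).antitone_countP_lt _ hij
  prefixCount_eq_rowLen i := by
    rw [prefixCount_insertionRow, rowLen_shape, List.countP_eq_length]
    exact fun a ha => by simpa using lt_of_mem_getD_insertionTableau σ ha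

variable {σ} in
theorem apply_eq_of_recordingRow_eq {τ : Equiv.Perm (Fin n)}
    (hrow : recordingRow σ = recordingRow τ) {m : ℕ} (hm : m ≤ n)
    (h : insertionTableau ((word σ).take m) = insertionTableau ((word τ).take m)) :
    ∀ j : Fin n, (j : ℕ) < m → σ j = τ j := by
  induction m with
  | zero => exact fun j hj => (Nat.not_lt_zero _ hj).elim
  | succ m ih =>
    rw [insertionTableau_take_succ σ ⟨m, hm⟩, insertionTableau_take_succ τ ⟨m, hm⟩] at h
    obtain ⟨hlast, hinit⟩ := tableauInsert_injective (isTableau_insertionTableau _)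
      (isTableau_insertionTableau _) (congrFun hrow ⟨m, hm⟩) h
    intro j hj
    rcases Nat.lt_succ_iff_lt_or_eq.1 hj with hj | hj
    · exact ih (Nat.le_of_succ_le hm) hinit j hj
    · obtain rfl : j = ⟨m, hm⟩ := Fin.ext hj
      exact Fin.ext hlast

theorem robinsonSchensted_injective :
    Function.Injective fun σ : Equiv.Perm (Fin n) => (insertionRow σ, recordingRow σ) := by
  intro σ τ h
  obtain ⟨hins, hrec⟩ := Prod.mk.inj h
  have hperm := flatten_insertionTableau_perm (word σ)
  have hP : insertionTableau (word σ) = insertionTableau (word τ) := by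
    refine (isTableau_insertionTableau _).eq_of_rowIndex_eq (isTableau_insertionTableau _)
      (hperm.nodup_iff.2 (nodup_word σ)) ?_ fun v hv => ?_
    · refine hperm.trans (.trans ?_ (flatten_insertionTableau_perm (word τ)).symm)
      exact (List.perm_ext_iff_of_nodup (nodup_word σ) (nodup_word τ)).2 fun a => by
        rw [mem_word, mem_word]
    · exact congrFun hins ⟨v, (mem_word σ).1 (hperm.mem_iff.1 hv)⟩
  refine Equiv.ext fun j => apply_eq_of_recordingRow_eq hrec le_rfl ?_ j j.isLt
  rw [take_word, take_word, hP]

theorem card_shape_eq_le (l : n.Partition) :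
    Nat.card {σ : Equiv.Perm (Fin n) // shape σ = l} ≤ l.numStandard ^ 2 := by
  have hins (σ : {σ : Equiv.Perm (Fin n) // shape σ = l}) : IsYamanouchi l (insertionRow σ.1) := by
    simpa only [σ.2] using isYamanouchi_insertionRow σ.1
  have hrec (σ : {σ : Equiv.Perm (Fin n) // shape σ = l}) : IsYamanouchi l (recordingRow σ.1) := by
    simpa only [σ.2] using isYamanouchi_recordingRow σ.1
  rw [sq, Nat.Partition.numStandard, ← Nat.card_prod]
  refine Nat.card_le_card_of_injective (fun σ => ((hins σ).tableau, (hrec σ).tableau)) ?_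
  intro σ τ h
  obtain ⟨hP, hQ⟩ := Prod.mk.inj h
  exact Subtype.ext (robinsonSchensted_injective
    (Prod.ext ((hins σ).tableau_injective (hins τ) hP) ((hrec σ).tableau_injective (hrec τ) hQ)))

theorem card_shape_mem (Γ : Finset n.Partition) :
    Nat.card {σ : Equiv.Perm (Fin n) // shape σ ∈ Γ}
      = ∑ l ∈ Γ, Nat.card {σ : Equiv.Perm (Fin n) // shape σ = l} := by
  classical
  simp only [Nat.card_eq_fintype_card, Fintype.card_subtype]
  rw [Finset.card_eq_sum_card_fiberwise (f := shape) (t := Γ) fun σ hσ => by simpa using hσ]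
  refine Finset.sum_congr rfl fun l hl => congrArg _ ?_
  ext σ
  simp only [Finset.mem_filter, Finset.mem_univ, true_and, and_iff_right_iff_imp]
  rintro rfl
  exact hl

theorem factorial_le_sum_numStandard_sq (n : ℕ) :
    n.factorial ≤ ∑ l : n.Partition, l.numStandard ^ 2 :=
  calc n.factorial = Nat.card {σ : Equiv.Perm (Fin n) // shape σ ∈ Finset.univ} := by
        simp [Nat.card_eq_fintype_card, Fintype.card_perm]
    _ = ∑ l, Nat.card {σ : Equiv.Perm (Fin n) // shape σ = l} := card_shape_mem _
    _ ≤ ∑ l : n.Partition, l.numStandard ^ 2 := Finset.sum_le_sum fun l _ => card_shape_eq_le l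

end RobinsonSchensted

/-! ## Increasing subsequences -/

namespace RobinsonSchensted

open IntegerPartition

/-- The colouring `c` splits the letters of `w` with a colour `< k` into increasing subsequences. -/
def IsIncreasingColouring (k : ℕ) (c : ℕ → ℕ) (w : List ℕ) : Prop :=
  w.Pairwise fun a b => c a = c b → c a < k → a < b

/-- The word `w` has `k` disjoint increasing subsequences with at least `m` letters altogether. -/
def HasIncreasing (k m : ℕ) (w : List ℕ) : Prop :=
  ∃ c, IsIncreasingColouring k c w ∧ m ≤ w.countP (c · < k)

/-- The concatenation of the rows of a tableau, from the bottom to the top. -/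
def readingWord : List (List ℕ) → List ℕ
  | [] => []
  | r :: rs => readingWord rs ++ r

theorem readingWord_perm (T : List (List ℕ)) : (readingWord T).Perm T.flatten := by
  induction T with
  | nil => rfl
  | cons r rs ih => exact List.perm_append_comm.trans (ih.append_left r)

variable {k m : ℕ}

theorem HasIncreasing.swap_of_lt {a b : List ℕ} {x z : ℕ} (hxz : x < z)
    (h : HasIncreasing k m (a ++ z :: x :: b)) : HasIncreasing k m (a ++ x :: z :: b) := by
  obtain ⟨c, hc, hcard⟩ := h
  refine ⟨c, ?_, by rwa [((List.Perm.swap z x b).append_left a).countP_eq]⟩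
  simp only [IsIncreasingColouring, List.pairwise_append, List.pairwise_cons, List.mem_cons] at hc ⊢
  grind

theorem isIncreasingColouring_comp_swap {a b : List ℕ} {x y z : ℕ} {c : ℕ → ℕ}
    (hnodup : (a ++ y :: x :: z :: b).Nodup) (hxy : x < y) (hyz : y < z)
    (hc : IsIncreasingColouring k c (a ++ y :: x :: z :: b)) (hxz : c x = c z) (hy : k ≤ c y) :
    IsIncreasingColouring k (c ∘ Equiv.swap x y) (a ++ y :: z :: x :: b) := by
  have hfix {v : ℕ} (hv : v ∈ a ∨ v ∈ b ∨ v = z) : Equiv.swap x y v = v := by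
    apply Equiv.swap_apply_of_ne_of_ne <;> rintro rfl <;> grind
  clear hnodup
  simp only [IsIncreasingColouring, List.pairwise_append, List.pairwise_cons, List.mem_cons,
    Function.comp_apply] at hc ⊢
  obtain ⟨ha, ⟨-, hx, hz, hb⟩, hab⟩ := hc
  refine ⟨ha.imp_of_mem fun hu hv h => ?_, ⟨?_, ?_, ?_, hb.imp_of_mem fun hu hv h => ?_⟩, ?_⟩
  · rwa [hfix (.inl hu), hfix (.inl hv)]
  · rintro v (rfl | rfl | hv)
    · exact fun _ _ => hyz
    · rw [Equiv.swap_apply_left, Equiv.swap_apply_right]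
      omega
    · rw [Equiv.swap_apply_right, hfix (.inr (.inl hv)), hxz]
      exact fun h h' => hyz.trans (hz v hv h h')
  · rintro v (rfl | hv)
    · rw [Equiv.swap_apply_left, hfix (.inr (.inr rfl))]
      omega
    · rw [hfix (.inr (.inl hv)), hfix (.inr (.inr rfl))]
      exact hz v hv
  · intro v _
    rw [Equiv.swap_apply_left]
    omega
  · rwa [hfix (.inr (.inl hu)), hfix (.inr (.inl hv))]
  · rintro u hu v (rfl | rfl | rfl | hv)
    · rw [hfix (.inl hu), Equiv.swap_apply_right]
      exact fun h h' => (hab u hu x (by simp) h h').trans hxy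
    · rw [hfix (.inl hu), hfix (.inr (.inr rfl))]
      exact hab u hu v (by simp)
    · rw [hfix (.inl hu), Equiv.swap_apply_left]
      omega
    · rw [hfix (.inl hu), hfix (.inr (.inl hv))]
      exact hab u hu v (by simp [hv])

theorem isIncreasingColouring_swap_tails {a b : List ℕ} {x y z : ℕ} {c : ℕ → ℕ}
    (hnodup : (a ++ y :: x :: z :: b).Nodup) (hxy : x < y) (hyz : y < z)
    (hc : IsIncreasingColouring k c (a ++ y :: x :: z :: b)) (hxz : c x = c z) (hx : c x < k)
    (hy : c y < k) :
    IsIncreasingColouring k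
      (fun v => if v ∈ z :: b then Equiv.swap (c x) (c y) (c v) else c v)
      (a ++ y :: z :: x :: b) := by
  have hmem {v : ℕ} (hv : v ∈ a ∨ v = x ∨ v = y) : v ∉ z :: b := by grind
  clear hnodup
  have hlt (i : ℕ) : Equiv.swap (c x) (c y) i < k ↔ i < k := by
    rw [Equiv.swap_apply_def]
    grind
  simp only [IsIncreasingColouring, List.pairwise_append, List.pairwise_cons, List.mem_cons]
    at hc hmem ⊢
  obtain ⟨ha, ⟨hy', hx', hz, hb⟩, hab⟩ := hc
  have hne : c y ≠ c x := fun h => by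
    have := hy' x (.inl rfl) h hy
    omega
  have hez : Equiv.swap (c x) (c y) (c z) = c y := by rw [← hxz, Equiv.swap_apply_left]
  have hey : Equiv.swap (c x) (c y) (c y) = c x := Equiv.swap_apply_right _ _
  have hefix {i : ℕ} (hi : i ≠ c x) (hi' : i ≠ c y) : Equiv.swap (c x) (c y) i = i :=
    Equiv.swap_apply_of_ne_of_ne hi hi'
  generalize Equiv.swap (c x) (c y) = e at *
  refine ⟨ha.imp_of_mem fun hu hv h => ?_, ⟨?_, ?_, ?_, hb.imp_of_mem fun hu hv h => ?_⟩, ?_⟩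
  · rwa [if_neg (hmem (.inl hu)), if_neg (hmem (.inl hv))]
  · have hyv (v) (hv : v ∈ b) : c y = e (c v) → c y < k → y < v := by
      rw [← hez, hlt, e.apply_eq_iff_eq]
      exact fun h h' => hyz.trans (hz v hv h h')
    grind
  · have hzv (v) (hv : v ∈ b) : e (c z) = e (c v) → e (c z) < k → z < v := by
      rw [e.apply_eq_iff_eq, hlt]
      exact hz v hv
    grind
  · grind
  · rwa [if_pos (.inr hu), if_pos (.inr hv), e.apply_eq_iff_eq, hlt]
  · grind

theorem map_swap_perm {α : Type*} [DecidableEq α] {w : List α} (hw : w.Nodup) {x y : α}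
    (hx : x ∈ w) (hy : y ∈ w) : (w.map (Equiv.swap x y)).Perm w := by
  refine ((hw.map (Equiv.swap x y).injective).subperm fun v hv => ?_).perm_of_length_le (by simp)
  obtain ⟨u, hu, rfl⟩ := List.mem_map.1 hv
  rw [Equiv.swap_apply_def]
  split_ifs <;> assumption

theorem HasIncreasing.knuth {a b : List ℕ} {x y z : ℕ}
    (hnodup : (a ++ y :: x :: z :: b).Nodup) (hxy : x < y) (hyz : y < z)
    (h : HasIncreasing k m (a ++ y :: x :: z :: b)) :
    HasIncreasing k m (a ++ y :: z :: x :: b) := by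
  obtain ⟨c, hc, hcard⟩ := h
  have hperm : (a ++ y :: z :: x :: b).Perm (a ++ y :: x :: z :: b) :=
    ((List.Perm.swap x z b).cons y).append_left a
  by_cases hxz : c x = c z ∧ c x < k
  · obtain hy | hy := lt_or_ge (c y) k
    · refine ⟨_, isIncreasingColouring_swap_tails hnodup hxy hyz hc hxz.1 hxz.2 hy, ?_⟩
      rw [hperm.countP_eq]
      refine hcard.trans_eq (List.countP_congr fun v _ => ?_)
      simp only [Equiv.swap_apply_def]
      grind
    · refine ⟨_, isIncreasingColouring_comp_swap hnodup hxy hyz hc hxz.1 hy, ?_⟩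
      rw [hperm.countP_eq]
      refine hcard.trans_eq ?_
      rw [← (map_swap_perm hnodup (x := x) (y := y) (by simp) (by simp)).countP_eq,
        List.countP_map]
      rfl
  · refine ⟨c, ?_, by rwa [hperm.countP_eq]⟩
    simp only [IsIncreasingColouring, List.pairwise_append, List.pairwise_cons, List.mem_cons]
      at hc ⊢
    clear hnodup hperm hcard
    grind

theorem HasIncreasing.move_right_of_lt {u a b : List ℕ} {y : ℕ} (hu : ∀ x ∈ u, x < y)
    (h : HasIncreasing k m (a ++ y :: (u ++ b))) : HasIncreasing k m (a ++ u ++ y :: b) := by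
  induction u generalizing a with
  | nil => simpa using h
  | cons x u ih =>
    have := ih (a := a ++ [x]) (fun v hv => hu v (by simp [hv]))
      (by simpa using h.swap_of_lt (hu x (by simp)))
    simpa using this

theorem HasIncreasing.move_right_of_sorted {v a b : List ℕ} {x y : ℕ}
    (hnodup : (a ++ y :: x :: (v ++ b)).Nodup) (hxy : x < y) (hv : (y :: v).Pairwise (· < ·))
    (h : HasIncreasing k m (a ++ y :: x :: (v ++ b))) :
    HasIncreasing k m (a ++ y :: v ++ x :: b) := by
  induction v generalizing a y with
  | nil => simpa using h
  | cons z v ih =>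
    have hyz : y < z := (List.pairwise_cons.1 hv).1 z (by simp)
    have hperm : (a ++ [y] ++ z :: x :: (v ++ b)).Perm (a ++ y :: x :: z :: (v ++ b)) := by
      simpa using ((List.Perm.swap x z (v ++ b)).cons y).append_left a
    have := ih (a := a ++ [y]) (hperm.nodup_iff.2 hnodup) (hxy.trans hyz)
      (List.pairwise_cons.1 hv).2
      (by simpa using h.knuth hnodup hxy hyz)
    simpa using this

theorem HasIncreasing.of_rowInsert {r a b : List ℕ} {x y : ℕ} (hr : r.Pairwise (· ≤ ·))
    (hnodup : (a ++ r ++ x :: b).Nodup) (hy : (rowInsert x r).2 = some y)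
    (h : HasIncreasing k m (a ++ y :: ((rowInsert x r).1 ++ b))) :
    HasIncreasing k m (a ++ r ++ x :: b) := by
  obtain ⟨u, v, rfl, hrow, hux, hxy⟩ := exists_append_of_rowInsert_snd_eq_some hy
  have hperm : (a ++ u ++ y :: x :: (v ++ b)).Perm (a ++ (u ++ y :: v) ++ x :: b) := by
    simpa using (List.perm_middle.symm.cons y).append_left (a ++ u)
  have hlt : (u ++ y :: v).Pairwise (· < ·) := by
    have hne : (u ++ y :: v).Nodup :=
      hnodup.sublist ((List.sublist_append_right a _).trans (List.sublist_append_left _ _))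
    exact hr.imp₂ (fun _ _ hle hne => lt_of_le_of_ne hle hne) hne
  rw [hrow, List.append_assoc, List.cons_append] at h
  have h₁ := h.move_right_of_lt (b := x :: (v ++ b)) (fun w hw => (hux w hw).trans_lt hxy)
  have := h₁.move_right_of_sorted (hperm.nodup_iff.2 hnodup) hxy (List.pairwise_append.1 hlt).2.1
  simpa using this

theorem HasIncreasing.of_tableauInsert {T : List (List ℕ)} {b : List ℕ} {x : ℕ} (hT : IsTableau T)
    (hnodup : (readingWord T ++ x :: b).Nodup)
    (h : HasIncreasing k m (readingWord (tableauInsert x T) ++ b)) :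
    HasIncreasing k m (readingWord T ++ x :: b) := by
  induction T generalizing x b with
  | nil => simpa [tableauInsert, readingWord] using h
  | cons r rs ih =>
    rw [tableauInsert] at h
    cases hy : (rowInsert x r).2 with
    | none => simpa [hy, (rowInsert_eq_of_snd_eq_none hy).1, readingWord] using h
    | some y =>
      have hperm : ((rowInsert x r).1 ++ [y]).Perm (x :: r) := by
        simpa [hy] using rowInsert_perm x r
      refine HasIncreasing.of_rowInsert hT.2.1 hnodup hy (ih hT.2.2.2 ?_ ?_)
      · refine List.Perm.nodup ?_ hnodup
        simp only [readingWord, List.append_assoc]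
        refine .append_left _ ((List.perm_middle.trans ?_))
        simpa using ((List.perm_append_singleton y _).symm.trans hperm).symm.append_right b
      · simpa [hy, readingWord] using h

theorem HasIncreasing.of_insertionTableau {w b : List ℕ} (hnodup : (w ++ b).Nodup)
    (h : HasIncreasing k m (readingWord (insertionTableau w) ++ b)) :
    HasIncreasing k m (w ++ b) := by
  induction w using List.reverseRecOn generalizing b with
  | nil => simpa [insertionTableau, readingWord] using h
  | append_singleton w x ih =>
    have hperm : (readingWord (insertionTableau w) ++ x :: b).Perm (w ++ x :: b) :=
      ((readingWord_perm _).trans (flatten_insertionTableau_perm w)).append_right _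
    have hnodup' : (w ++ x :: b).Nodup := by simpa using hnodup
    have := ih hnodup' (HasIncreasing.of_tableauInsert (isTableau_insertionTableau w)
      (hperm.nodup_iff.2 hnodup') (by simpa [insertionTableau] using h))
    simpa using this

theorem isIncreasingColouring_rowIndex {T : List (List ℕ)} (hT : IsTableau T)
    (hnodup : T.flatten.Nodup) : IsIncreasingColouring k (rowIndex T) (readingWord T) := by
  induction T with
  | nil => exact List.Pairwise.nil
  | cons r rs ih =>
    have hnodup' := List.nodup_append.1 (List.flatten_cons ▸ hnodup)
    have htop {v : ℕ} (hv : v ∈ r) : rowIndex (r :: rs) v = 0 := by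
      simp [rowIndex, List.findIdx_cons, hv]
    have hrest {v : ℕ} (hv : v ∈ readingWord rs) : rowIndex (r :: rs) v = rowIndex rs v + 1 := by
      have hvr : v ∉ r := fun h => hnodup'.2.2 v h v ((readingWord_perm rs).mem_iff.1 hv) rfl
      simp [rowIndex, List.findIdx_cons, hvr]
    refine List.pairwise_append.2 ⟨(ih hT.2.2.2 hnodup'.2.1).imp_of_mem fun ha hb h => ?_,
      hT.2.1.imp₂ (fun _ _ hle hne _ _ => lt_of_le_of_ne hle hne) hnodup'.1, fun a ha b hb h => ?_⟩
    · rw [hrest ha, hrest hb]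
      exact fun hab hlt => h (by omega) (by omega)
    · rw [hrest ha, htop hb] at h
      omega

variable {n : ℕ} (σ : Equiv.Perm (Fin n))

theorem card_insertionRow_lt (k : ℕ) :
    (Finset.univ.filter fun v => insertionRow σ v < k).card = (shape σ).partialSum k :=
  HasContent.card_filter_lt
    (fun i => by simp [← (isYamanouchi_insertionRow σ).prefixCount_eq_rowLen, prefixCount]) k

theorem hasIncreasing_word (k : ℕ) : HasIncreasing k ((shape σ).partialSum k) (word σ) := by
  have hperm := flatten_insertionTableau_perm (word σ)
  have hnodup := hperm.nodup_iff.2 (nodup_word σ)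
  have := HasIncreasing.of_insertionTableau (k := k) (m := (shape σ).partialSum k)
    (w := word σ) (b := []) (by simpa using nodup_word σ)
    ⟨_, by simpa using isIncreasingColouring_rowIndex (isTableau_insertionTableau _) hnodup, ?_⟩
  · simpa using this
  · rw [List.append_nil, ((readingWord_perm _).trans hperm).countP_eq,
      countP_eq_card_filter (nodup_word σ) (fun a => (mem_word σ).1), ← card_insertionRow_lt]
    refine Finset.card_le_card fun v hv => ?_
    have hlt := (Finset.mem_filter.1 hv).2
    rw [insertionRow] at hlt
    simpa [mem_word] using hlt

/-- The remaining letters receive pairwise different colours, so that all colour classes are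
increasing. -/
theorem exists_increasing_colouring (k : ℕ) :
    ∃ c : Fin n → ℕ, (∀ i j, i < j → c (σ i) = c (σ j) → σ i < σ j) ∧
      (shape σ).partialSum k ≤ (Finset.univ.filter fun v => c v < k).card := by
  obtain ⟨c, hc, hcard⟩ := hasIncreasing_word σ k
  refine ⟨fun v => if c v < k then c v else k + v, fun i j hij h => ?_, ?_⟩
  · have := List.pairwise_ofFn.1 hc hij
    have hne : (σ i : ℕ) ≠ σ j := fun h => hij.ne (σ.injective (Fin.ext h))
    grind
  · rw [countP_eq_card_filter (nodup_word σ) (fun a => (mem_word σ).1)] at hcard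
    refine hcard.trans (Finset.card_le_card fun v hv => ?_)
    simp_all

end RobinsonSchensted

/-! ## Blocks, rows and columns -/

namespace IntegerPartition

open Nat.Partition

variable {n : ℕ}

/-- The index of the block of `l` that contains `v`. -/
def blockIdx (l : n.Partition) (v : Fin n) : ℕ :=
  Nat.find (p := fun k => (v : ℕ) < l.partialSum (k + 1))
    ⟨n, v.isLt.trans_le (((partialSum_eq_sum l n).trans (sum_rowLen l)).symm.le.trans
      (partialSum_mono l n.le_succ))⟩

theorem blockIdx_lt_iff (l : n.Partition) (v : Fin n) (k : ℕ) :
    blockIdx l v < k ↔ (v : ℕ) < l.partialSum k := by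
  rw [blockIdx, Nat.find_lt_iff]
  refine ⟨fun ⟨m, hm, h⟩ => h.trans_le (partialSum_mono l hm), fun h => ?_⟩
  cases k with
  | zero => simp [partialSum] at h
  | succ k => exact ⟨k, k.lt_succ_self, h⟩

theorem mem_youngSubgroup_iff (l : n.Partition) (σ : Equiv.Perm (Fin n)) :
    σ ∈ l.youngSubgroup ↔ ∀ v, blockIdx l (σ v) = blockIdx l v := by
  have hblock (v : Fin n) (k : ℕ) : v ∈ l.block k ↔ blockIdx l v = k := by
    have hk := blockIdx_lt_iff l v k
    have hk' := blockIdx_lt_iff l v (k + 1)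
    rw [block, Set.mem_ofPred_eq]
    omega
  change (∀ k i, σ i ∈ l.block k ↔ i ∈ l.block k) ↔ _
  simp only [hblock]
  exact ⟨fun h v => (h _ v).2 rfl, fun h k i => by rw [h]⟩

theorem hasContent_blockIdx (l : n.Partition) : HasContent l (blockIdx l) := by
  intro k
  have hlt (j : ℕ) : (Finset.univ.filter fun v => blockIdx l v < j).card = l.partialSum j := by
    simp only [blockIdx_lt_iff]
    rw [Fin.card_filter_val_lt, min_eq_right (partialSum_le l j)]
  have hsdiff : (Finset.univ.filter fun v => blockIdx l v = k)
      = (Finset.univ.filter fun v => blockIdx l v < k + 1)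
        \ Finset.univ.filter fun v => blockIdx l v < k := by
    ext v
    simp only [Finset.mem_sdiff, Finset.mem_filter, Finset.mem_univ, true_and]
    omega
  rw [hsdiff, Finset.card_sdiff_of_subset
    (Finset.monotone_filter_right _ fun v _ h => Nat.lt_succ_of_lt h), hlt, hlt,
    partialSum_eq_sum, partialSum_eq_sum, Finset.sum_range_succ, Nat.add_sub_cancel_left]

section Entries

variable {l l' : n.Partition}

/-- The row that contains the entry `v`. -/
def entryRow (t : l.StandardTableau) (v : Fin n) : ℕ := (t.1.symm v).1.1

/-- The column that contains the entry `v`. -/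
def entryCol (t : l.StandardTableau) (v : Fin n) : ℕ := (t.1.symm v).1.2

theorem entryCol_lt_rowLen (t : l.StandardTableau) (v : Fin n) :
    entryCol t v < rowLen l (entryRow t v) :=
  (mem_diagram l _).1 (t.1.symm v).2

theorem exists_entry (t : l.StandardTableau) {i j : ℕ} (h : j < rowLen l i) :
    ∃ v, entryRow t v = i ∧ entryCol t v = j :=
  ⟨t.1 ⟨(i, j), (mem_diagram l _).2 h⟩, by simp [entryRow], by simp [entryCol]⟩

theorem eq_of_entryRow_eq_of_entryCol_eq (t : l.StandardTableau) {u v : Fin n}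
    (hrow : entryRow t u = entryRow t v) (hcol : entryCol t u = entryCol t v) : u = v :=
  t.1.symm.injective (Subtype.ext (Prod.ext hrow hcol))

theorem lt_of_entryRow_eq (t : l.StandardTableau) {u v : Fin n}
    (hrow : entryRow t u = entryRow t v) (hcol : entryCol t u < entryCol t v) : u < v := by
  simpa using t.2.1 (t.1.symm u) (t.1.symm v) hrow hcol

theorem lt_of_entryCol_eq (t : l.StandardTableau) {u v : Fin n}
    (hcol : entryCol t u = entryCol t v) (hrow : entryRow t u < entryRow t v) : u < v := by
  simpa using t.2.2 (t.1.symm u) (t.1.symm v) hcol hrow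

theorem hasContent_entryRow (t : l.StandardTableau) : HasContent l (entryRow t) := by
  intro i
  rw [← Finset.card_range (rowLen l i)]
  refine Finset.card_nbij (entryCol t) (fun v hv => ?_) (fun u hu v hv => ?_) (fun j hj => ?_)
  · obtain rfl : entryRow t v = i := by simpa using hv
    simpa using entryCol_lt_rowLen t v
  · have huv : entryRow t u = entryRow t v := by simp_all
    exact eq_of_entryRow_eq_of_entryCol_eq t huv
  · obtain ⟨v, hrow, hcol⟩ := exists_entry t (by simpa using hj)
    exact ⟨v, by simpa using hrow, hcol⟩

theorem entryCol_eq_prefixCount (t : l.StandardTableau) (v : Fin n) :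
    entryCol t v = prefixCount (entryRow t) v (entryRow t v) := by
  rw [← Finset.card_range (entryCol t v), prefixCount]
  symm
  refine Finset.card_nbij (entryCol t) (fun u hu => ?_) (fun u hu w hw => ?_) (fun j hj => ?_)
  · obtain ⟨huv, hrow⟩ : u < v ∧ entryRow t u = entryRow t v := by simpa using hu
    rw [Finset.mem_coe, Finset.mem_range]
    by_contra! h
    rcases h.eq_or_lt with hcol | hcol
    · exact huv.ne (eq_of_entryRow_eq_of_entryCol_eq t hrow hcol.symm)
    · exact lt_asymm huv (lt_of_entryRow_eq t hrow.symm hcol)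
  · have huw : entryRow t u = entryRow t w := by simp_all
    exact eq_of_entryRow_eq_of_entryCol_eq t huw
  · have hjv : j < entryCol t v := by simpa using hj
    obtain ⟨u, hrow, hcol⟩ := exists_entry t (hjv.trans (entryCol_lt_rowLen t v))
    exact ⟨u, by simpa [hrow] using lt_of_entryRow_eq t hrow (hcol ▸ hjv), hcol⟩

theorem entryRow_injective : Function.Injective (entryRow : l.StandardTableau → Fin n → ℕ) := by
  intro t t' h
  refine Subtype.ext (Equiv.symm_bijective.injective (Equiv.ext fun v => ?_))
  refine Subtype.ext (Prod.ext (congrFun h v) ?_)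
  change entryCol t v = entryCol t' v
  rw [entryCol_eq_prefixCount, entryCol_eq_prefixCount, h]

theorem forall_entryRow_eq_and_entryCol_eq_iff (s t : l.StandardTableau) (π : Equiv.Perm (Fin n)) :
    ((∀ v, entryRow s (π v) = entryRow t v) ∧ ∀ v, entryCol s (π v) = entryCol t v)
      ↔ π = t.1.symm.trans s.1 := by
  refine ⟨fun ⟨hrow, hcol⟩ => Equiv.ext fun v => eq_of_entryRow_eq_of_entryCol_eq s ?_ ?_, ?_⟩
  · rw [hrow]
    simp [entryRow]
  · rw [hcol]
    simp [entryCol]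
  · rintro rfl
    simp [entryRow, entryCol]

end Entries

/-! ## Dominance of labellings -/

/-- The number of elements smaller than `m` with label smaller than `k`. For the rows of a
tableau these numbers are the partial sums of the shapes of its subtableaux. -/
def spread (r : Fin n → ℕ) (m k : ℕ) : ℕ :=
  (Finset.univ.filter fun v : Fin n => (v : ℕ) < m ∧ r v < k).card

theorem HasContent.spread_self {l : n.Partition} {b : Fin n → ℕ}
    (hb : HasContent l b) (k : ℕ) :
    spread b n k = l.partialSum k := by
  simp [← hb.card_filter_lt, spread]

theorem spread_injective : Function.Injective (spread : (Fin n → ℕ) → ℕ → ℕ → ℕ) := by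
  have hstep (r : Fin n → ℕ) (v : Fin n) (k : ℕ) :
      spread r (v + 1) k = spread r v k + if r v < k then 1 else 0 := by
    have := prefixCount_succ (fun u => if r u < k then 1 else 0) v 1
    simpa [prefixCount, spread] using this
  refine fun r r' h => funext fun v => eq_of_forall_gt_iff fun k => ?_
  have hr := hstep r v k
  rw [h, hstep r' v k] at hr
  split_ifs at hr <;> omega

theorem card_filter_lt_le_sum_min {α β : Type*} [DecidableEq β] {S : Finset α} {b : α → ℕ}
    {g : α → β} {T : Finset β} (hT : ∀ v ∈ S, g v ∈ T)
    (hbg : ∀ u v, b u = b v → g u = g v → u = v) (k : ℕ) :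
    (S.filter fun v => b v < k).card ≤ ∑ j ∈ T, min k (S.filter fun v => g v = j).card := by
  rw [Finset.card_eq_sum_card_fiberwise (f := g) (t := T)
    (fun v hv => hT v (Finset.mem_filter.1 hv).1)]
  refine Finset.sum_le_sum fun j _ => le_min ?_ (Finset.card_le_card ?_)
  · conv_rhs => rw [← Finset.card_range k]
    refine Finset.card_le_card_of_injOn b (fun v hv => ?_) fun u hu v hv huv => hbg u v huv ?_
    · simp_all
    · simp_all
  · exact Finset.filter_subset_filter _ (Finset.filter_subset _ _)

theorem min_card_entryCol_eq_le {l : n.Partition} (t : l.StandardTableau) (m k j : ℕ) :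
    min k (Finset.univ.filter fun v : Fin n => (v : ℕ) < m ∧ entryCol t v = j).card
      ≤ (Finset.univ.filter fun v : Fin n => ((v : ℕ) < m ∧ entryRow t v < k)
          ∧ entryCol t v = j).card := by
  by_cases h : ∀ v : Fin n, (v : ℕ) < m → entryCol t v = j → entryRow t v < k
  · refine (min_le_right _ _).trans (Finset.card_le_card fun v hv => ?_)
    simp_all
  · push Not at h
    obtain ⟨v, hvm, rfl, hk⟩ := h
    refine (min_le_left _ _).trans ?_
    conv_lhs => rw [← Finset.card_range k]
    refine Finset.card_le_card_of_surjOn (entryRow t) fun i hi => ?_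
    have hik : i < k := by simpa using hi
    obtain ⟨u, hrow, hcol⟩ := exists_entry t
      ((entryCol_lt_rowLen t v).trans_le (rowLen_antitone l (hik.le.trans hk)))
    have huv : u < v := lt_of_entryCol_eq t hcol (hrow.trans_lt (hik.trans_le hk))
    refine ⟨u, ?_, hrow⟩
    simpa [hrow, hcol, hik] using (Fin.lt_def.1 huv).trans hvm

theorem spread_le_spread_entryRow {l : n.Partition} {b : Fin n → ℕ} (t : l.StandardTableau)
    (hbt : ∀ u v, b u = b v → entryCol t u = entryCol t v → u = v) (m k : ℕ) :
    spread b m k ≤ spread (entryRow t) m k := by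
  let T := Finset.univ.image (entryCol t)
  calc spread b m k
      ≤ ∑ j ∈ T,
          min k (Finset.univ.filter fun v : Fin n => (v : ℕ) < m ∧ entryCol t v = j).card := by
        simpa only [spread, Finset.filter_filter] using card_filter_lt_le_sum_min
          (S := Finset.univ.filter fun v : Fin n => (v : ℕ) < m) (T := T) (by simp [T]) hbt k
    _ ≤ ∑ j ∈ T, (Finset.univ.filter fun v : Fin n => ((v : ℕ) < m ∧ entryRow t v < k)
          ∧ entryCol t v = j).card :=
        Finset.sum_le_sum fun j _ => min_card_entryCol_eq_le t m k j
    _ = spread (entryRow t) m k := by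
        rw [spread, Finset.card_eq_sum_card_fiberwise (f := entryCol t) (t := T)
          fun v _ => by simp [T]]
        simp only [Finset.filter_filter]

theorem HasContent.card_filter_lt_le_partialSum_conj {l : n.Partition} {b c : Fin n → ℕ}
    (hb : HasContent l b)
    (hbc : ∀ u v, b u = b v → c u = c v → u = v) (k : ℕ) :
    (Finset.univ.filter fun v => c v < k).card ≤ l.conj.partialSum k := by
  rw [partialSum_conj]
  simp only [← hb _]
  refine card_filter_lt_le_sum_min (fun v _ => ?_) (fun u v hc hb => hbc u v hb hc) k
  by_contra hv
  have := rowLen_eq_zero l (Finset.mem_range.not.1 hv |> not_lt.1)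
  rw [← hb _, Finset.card_eq_zero, Finset.filter_eq_empty_iff] at this
  exact this (Finset.mem_univ v) rfl

end IntegerPartition

/-! ## Triangular pairings and leading indices -/

namespace LinearPairing

theorem isUnit_det_of_triangular {ι α R : Type*} [Fintype ι] [DecidableEq ι] [PartialOrder α]
    [CommRing R] {M : Matrix ι ι R} {r : ι → α} (hr : Function.Injective r)
    (hM : ∀ p q, M p q ≠ 0 → r q ≤ r p) (hdiag : ∀ p, IsUnit (M p p)) : IsUnit M.det := by
  let rank (p : ι) : LinearExtension α := toLinearExtension (r p)
  have hrank : Function.Injective rank := fun p q h => hr h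
  let : LinearOrder ι := LinearOrder.lift' rank hrank
  have htri : M.IsLowerTriangular := fun p q hpq => by
    by_contra h
    have hle : rank q ≤ rank p := toLinearExtension.monotone (hM p q h)
    exact hle.not_gt hpq
  have hdet : M.det = ∏ p, M p p := by convert Matrix.det_of_isLowerTriangular M htri
  exact hdet ▸ IsUnit.prod_univ_iff.2 hdiag

section

variable {ι R M : Type*} [Fintype ι] [DecidableEq ι] [CommRing R] [AddCommGroup M] [Module R M]
  {φ : ι → M →ₗ[R] R} {v : ι → M}

theorem eq_zero_of_forall_apply_sum_eq_zero
    (hdet : IsUnit (Matrix.of fun p q => φ p (v q)).det) {c : ι → R}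
    (hc : ∀ p, φ p (∑ q, c q • v q) = 0) : c = 0 := by
  refine Matrix.mulVec_injective_of_isUnit ((Matrix.isUnit_iff_isUnit_det _).2 hdet) ?_
  rw [Matrix.mulVec_zero]
  funext p
  simpa [Matrix.mulVec, dotProduct, mul_comm] using hc p

theorem linearIndependent_of_isUnit_det (hdet : IsUnit (Matrix.of fun p q => φ p (v q)).det) :
    LinearIndependent R v :=
  Fintype.linearIndependent_iff.2 fun c hc => congrFun <|
    eq_zero_of_forall_apply_sum_eq_zero hdet fun p => by rw [hc, map_zero]

theorem span_eq_top_of_isUnit_det (e : Module.Basis ι R M)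
    (hdet : IsUnit (Matrix.of fun p q => φ p (v q)).det) :
    Submodule.span R (Set.range v) = ⊤ := by
  have hmul : (Matrix.of fun p q => φ p (v q))
      = (Matrix.of fun p i => φ p (e i)) * e.toMatrix v := by
    ext p q
    calc φ p (v q) = φ p (∑ i, e.repr (v q) i • e i) := by rw [e.sum_repr]
      _ = _ := by simp [-Module.Basis.sum_repr, Matrix.mul_apply, Module.Basis.toMatrix_apply,
        mul_comm]
  rw [hmul, Matrix.det_mul] at hdet
  exact (e.is_basis_iff_det.2 (isUnit_of_mul_isUnit_right hdet)).2

end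

section Leading

variable {ι K M : Type*} [LinearOrder ι] [Field K] [AddCommGroup M] [Module K M]

/-- The indices of the leading coefficients, with respect to the basis `b`, of the nonzero elements
of `V`. -/
def leadingIndices (b : Module.Basis ι K M) (V : Submodule K M) : Set ι :=
  {i | ∃ x ∈ V, b.repr x i ≠ 0 ∧ ∀ j, i < j → b.repr x j = 0}

variable (b : Module.Basis ι K M)

theorem leadingIndices_mono : Monotone (leadingIndices b) :=
  fun _ _ h _ ⟨x, hx, hlead⟩ => ⟨x, h hx, hlead⟩

theorem exists_leading_index {x : M} (hx : x ≠ 0) :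
    ∃ i, b.repr x i ≠ 0 ∧ ∀ j, i < j → b.repr x j = 0 := by
  have hne : (b.repr x).support.Nonempty := by simpa using hx
  refine ⟨_, Finsupp.mem_support_iff.1 (Finset.max'_mem _ hne), fun j hj => ?_⟩
  by_contra h
  exact hj.not_ge (Finset.le_max' _ j (Finsupp.mem_support_iff.2 h))

theorem card_leadingIndices [Finite ι] (V : Submodule K M) :
    Nat.card (leadingIndices b V) = Module.finrank K V := by
  classical
  have := Fintype.ofFinite ι
  have := Module.Finite.of_basis b
  rw [Nat.card_eq_fintype_card]
  apply le_antisymm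
  · choose x hxV hxne hxlt using fun i : leadingIndices b V => i.2
    have htri : IsUnit (Matrix.of fun p q => (b.coord p.1 ∘ₗ V.subtype) ⟨x q, hxV q⟩).det :=
      isUnit_det_of_triangular (r := fun p => OrderDual.toDual p.1)
        (fun p q h => Subtype.ext h) (fun p q h => not_lt.1 fun hlt => h (hxlt q p hlt))
        fun p => (hxne p).isUnit
    exact (linearIndependent_of_isUnit_det htri).fintype_card_le_finrank
  · let coords : V →ₗ[K] leadingIndices b V → K := LinearMap.pi fun i => b.coord i.1 ∘ₗ V.subtype
    have hinj : Function.Injective coords := by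
      refine (injective_iff_map_eq_zero coords).2 fun x hx => ?_
      by_contra hne
      obtain ⟨i, hi, hlt⟩ := exists_leading_index b (Subtype.coe_ne_coe.2 hne)
      exact hi (congrFun hx ⟨i, x, x.2, hi, hlt⟩)
    simpa using LinearMap.finrank_le_finrank_of_injective hinj

end Leading

end LinearPairing

/-! ## Sums and signed forms attached to labellings -/

namespace SymGroupAlgebra

open IntegerPartition LinearPairing

variable {n : ℕ} (R : Type*) [CommRing R]

/-- The permutations that carry the labelling `g` to the labelling `f`. -/
def carrying (f g : Fin n → ℕ) : Finset (Equiv.Perm (Fin n)) :=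
  Finset.univ.filter fun π => ∀ v, f (π v) = g v

theorem mem_carrying {f g : Fin n → ℕ} {π : Equiv.Perm (Fin n)} :
    π ∈ carrying f g ↔ ∀ v, f (π v) = g v := by
  simp [carrying]

theorem inv_mem_carrying {f g : Fin n → ℕ} {π : Equiv.Perm (Fin n)} :
    π⁻¹ ∈ carrying g f ↔ π ∈ carrying f g := by
  rw [mem_carrying, mem_carrying]
  exact ⟨fun h v => by simpa using (h (π v)).symm, fun h v => by simpa using (h (π⁻¹ v)).symm⟩

/-- The sum of the permutations that carry the labelling `g` to the labelling `f`. These are the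
translates of the sums of Young subgroups. -/
noncomputable def carryingSum (f g : Fin n → ℕ) : MonoidAlgebra R (Equiv.Perm (Fin n)) :=
  ∑ π ∈ carrying f g, MonoidAlgebra.of R _ π

theorem of_mul_groupSum_mul_of (l : n.Partition) (α β : Equiv.Perm (Fin n)) :
    MonoidAlgebra.of R _ α * groupSum R l.youngSubgroup * MonoidAlgebra.of R _ β
      = carryingSum R (blockIdx l ∘ ⇑α⁻¹) (blockIdx l ∘ ⇑β) := by
  classical
  rw [groupSum, Finset.mul_sum, Finset.sum_mul, carryingSum]
  refine Finset.sum_equiv ((Equiv.mulLeft α).trans (Equiv.mulRight β)) (fun σ => ?_)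
    (fun σ _ => by simp [map_mul])
  simp only [Finset.mem_filter, Finset.mem_univ, true_and, mem_carrying, mem_youngSubgroup_iff,
    Equiv.trans_apply, Equiv.coe_mulLeft, Equiv.coe_mulRight, Equiv.Perm.mul_apply,
    Equiv.Perm.coe_inv, Equiv.symm_apply_apply, Function.comp_apply]
  exact ⟨fun h v => h (β v), fun h v => by simpa using h (β⁻¹ v)⟩

theorem hasContent_blockIdx_comp (l : n.Partition) (β : Equiv.Perm (Fin n)) :
    HasContent l (blockIdx l ∘ ⇑β) := fun i => by
  rw [← hasContent_blockIdx l i]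
  exact Finset.card_equiv β fun v => by simp

theorem exists_perm_of_hasContent {l : n.Partition} {f g : Fin n → ℕ} (hf : HasContent l f)
    (hg : HasContent l g) : ∃ τ : Equiv.Perm (Fin n), f ∘ ⇑τ = g := by
  have hfib (i : ℕ) : Nonempty ({v // g v = i} ≃ {v // f v = i}) :=
    ⟨Fintype.equivOfCardEq (by rw [Fintype.card_subtype, Fintype.card_subtype, hf i, hg i])⟩
  exact ⟨Equiv.ofFiberEquiv fun i => (hfib i).some, funext (Equiv.ofFiberEquiv_map _)⟩

theorem carryingSum_mem_youngIdeal {Δ : Finset n.Partition} {l : n.Partition} (hl : l ∈ Δ)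
    {f g : Fin n → ℕ} (hf : HasContent l f) (hg : HasContent l g) :
    carryingSum R f g ∈ youngIdeal R Δ := by
  obtain ⟨α, rfl⟩ := exists_perm_of_hasContent (hasContent_blockIdx l) hf
  obtain ⟨β, rfl⟩ := exists_perm_of_hasContent (hasContent_blockIdx l) hg
  have htranslate := of_mul_groupSum_mul_of R l α⁻¹ β
  rw [inv_inv] at htranslate
  rw [← htranslate, youngIdeal, Submodule.restrictScalars_mem, TwoSidedIdeal.mem_asIdeal]
  exact TwoSidedIdeal.mul_mem_right _ _ _ (TwoSidedIdeal.mul_mem_left _ _ _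
    (TwoSidedIdeal.subset_span ⟨l, hl, rfl⟩))

theorem coe_of_eq_coe_basis :
    ⇑(MonoidAlgebra.of R (Equiv.Perm (Fin n))) = ⇑(MonoidAlgebra.basis _ R) := by
  ext1 σ
  simp

/-- The signed sum of the coefficients at the permutations that carry `g` to `f`. -/
noncomputable def signedForm (f g : Fin n → ℕ) : MonoidAlgebra R (Equiv.Perm (Fin n)) →ₗ[R] R :=
  ∑ π ∈ carrying f g, ((Equiv.Perm.sign π : ℤ) : R) • (MonoidAlgebra.basis _ R).coord π

theorem signedForm_apply (f g : Fin n → ℕ) (x : MonoidAlgebra R (Equiv.Perm (Fin n))) :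
    signedForm R f g x = ∑ π ∈ carrying f g,
      ((Equiv.Perm.sign π : ℤ) : R) * (MonoidAlgebra.basis _ R).repr x π := by
  simp [signedForm]

theorem signedForm_carryingSum (f g a b : Fin n → ℕ) :
    signedForm R f g (carryingSum R a b)
      = ∑ π ∈ carrying a b ∩ carrying f g, ((Equiv.Perm.sign π : ℤ) : R) := by
  have hof (σ : Equiv.Perm (Fin n)) : signedForm R f g (MonoidAlgebra.of R _ σ)
      = if σ ∈ carrying f g then ((Equiv.Perm.sign σ : ℤ) : R) else 0 := by
    simp [signedForm_apply, coe_of_eq_coe_basis, Finsupp.single_apply, -MonoidAlgebra.of_apply,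
      -MonoidAlgebra.basis_apply]
  rw [carryingSum, map_sum, Finset.sum_congr rfl fun π _ => hof π, ← Finset.sum_filter,
    Finset.filter_mem_eq_inter]

theorem signedForm_carryingSum_swap (f g a b : Fin n → ℕ) :
    signedForm R f g (carryingSum R a b) = signedForm R g f (carryingSum R b a) := by
  rw [signedForm_carryingSum, signedForm_carryingSum]
  refine Finset.sum_equiv (Equiv.inv _) (fun π => ?_) (fun π _ => ?_)
  · simp only [Finset.mem_inter, Equiv.inv_apply, inv_mem_carrying]
  · rw [Equiv.inv_apply, Equiv.Perm.sign_inv]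

theorem signedForm_carryingSum_eq_zero_of_eq_left {f g a b : Fin n → ℕ} {u v : Fin n} (huv : u ≠ v)
    (ha : a u = a v) (hf : f u = f v) : signedForm R f g (carryingSum R a b) = 0 := by
  have hswap {h : Fin n → ℕ} (huv : h u = h v) (w : Fin n) : h (Equiv.swap u v w) = h w := by
    rw [Equiv.swap_apply_def]
    split_ifs <;> simp_all
  rw [signedForm_carryingSum]
  refine Finset.sum_involution (fun π _ => Equiv.swap u v * π) (fun π _ => ?_) (fun π _ _ h => ?_)
    (fun π hπ => ?_) (fun π _ => ?_)
  · simp [Equiv.Perm.sign_swap huv]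
  · exact huv (by simpa using h)
  · simpa only [Finset.mem_inter, mem_carrying, Equiv.Perm.mul_apply, hswap ha, hswap hf] using hπ
  · simp [← mul_assoc]

theorem signedForm_carryingSum_eq_zero_of_eq_right {f g a b : Fin n → ℕ} {u v : Fin n}
    (huv : u ≠ v) (hb : b u = b v) (hg : g u = g v) :
    signedForm R f g (carryingSum R a b) = 0 := by
  rw [signedForm_carryingSum_swap]
  exact signedForm_carryingSum_eq_zero_of_eq_left R huv hb hg

theorem signedForm_eq_zero_of_mem_youngIdeal {Δ : Finset n.Partition} {f g : Fin n → ℕ}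
    (hg : ∀ l ∈ Δ, ∀ b, HasContent l b → ∃ u v, u ≠ v ∧ b u = b v ∧ g u = g v)
    {x : MonoidAlgebra R (Equiv.Perm (Fin n))} (hx : x ∈ youngIdeal R Δ) :
    signedForm R f g x = 0 := by
  rw [youngIdeal, Submodule.restrictScalars_mem, TwoSidedIdeal.mem_asIdeal,
    TwoSidedIdeal.mem_span_iff_mem_addSubgroup_closure] at hx
  induction hx using AddSubgroup.closure_induction with
  | mem x hx =>
    obtain ⟨-, ⟨a, -, -, ⟨l, hl, rfl⟩, rfl⟩, b, -, rfl⟩ := hx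
    change signedForm R f g (a * groupSum R l.youngSubgroup * b) = 0
    induction a using MonoidAlgebra.induction_on with
    | of α =>
      induction b using MonoidAlgebra.induction_on with
      | of β =>
        obtain ⟨u, v, huv, hb, hgv⟩ := hg l hl _ (hasContent_blockIdx_comp l β)
        rw [of_mul_groupSum_mul_of, signedForm_carryingSum_eq_zero_of_eq_right R huv hb hgv]
      | add b b' hb hb' => rw [mul_add, map_add, hb, hb', add_zero]
      | smul r b hb => rw [mul_smul_comm, map_smul, hb, smul_zero]
    | add a a' ha ha' => rw [add_mul, add_mul, map_add, ha, ha', add_zero]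
    | smul r a ha => rw [smul_mul_assoc, smul_mul_assoc, map_smul, ha, smul_zero]
  | zero => exact map_zero _
  | add x y _ _ hx hy => rw [map_add, hx, hy, add_zero]
  | neg x _ hx => rw [map_neg, hx, neg_zero]

end SymGroupAlgebra

/-! ## The basis of row sums -/

namespace SymGroupAlgebra

open IntegerPartition LinearPairing

variable {n : ℕ} (R : Type*) [CommRing R]

/-- Pairs of standard tableaux of the same shape with `n` cells. -/
abbrev TableauPair (n : ℕ) : Type :=
  Σ l : n.Partition, l.StandardTableau × l.StandardTableau

noncomputable instance (l : n.Partition) : Fintype l.StandardTableau := Fintype.ofFinite _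

/-- The sum of the permutations that carry the rows of the second tableau of `p` to those of the
first. -/
noncomputable def rowSum (p : TableauPair n) : MonoidAlgebra R (Equiv.Perm (Fin n)) :=
  carryingSum R (entryRow p.2.1) (entryRow p.2.2)

/-- The signed sum of the coefficients at the permutations that carry the columns of the second
tableau of `p` to those of the first. -/
noncomputable def colForm (p : TableauPair n) : MonoidAlgebra R (Equiv.Perm (Fin n)) →ₗ[R] R :=
  signedForm R (entryCol p.2.1) (entryCol p.2.2)

/-- The spreads of the rows of the two tableaux of `p`. Their pointwise order is the one with
respect to which the forms and the row sums are in triangular position. -/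
def pairSpread (p : TableauPair n) : (ℕ → ℕ → ℕ) × (ℕ → ℕ → ℕ) :=
  (spread (entryRow p.2.1), spread (entryRow p.2.2))

theorem pairSpread_injective : Function.Injective (pairSpread (n := n)) := by
  rintro ⟨l, s, t⟩ ⟨l', s', t'⟩ h
  have hs : entryRow s = entryRow s' := spread_injective (Prod.mk.inj h).1
  have ht : entryRow t = entryRow t' := spread_injective (Prod.mk.inj h).2
  obtain rfl : l = l' := eq_of_rowLen_eq fun i => by
    rw [← hasContent_entryRow s, ← hasContent_entryRow s', hs]
  rw [entryRow_injective hs, entryRow_injective ht]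

theorem pairSpread_le_of_colForm_ne_zero {p q : TableauPair n} (h : colForm R p (rowSum R q) ≠ 0) :
    pairSpread q ≤ pairSpread p := by
  constructor
  · refine spread_le_spread_entryRow _ fun u v hrow hcol => ?_
    by_contra huv
    exact h (signedForm_carryingSum_eq_zero_of_eq_left R huv hrow hcol)
  · refine spread_le_spread_entryRow _ fun u v hrow hcol => ?_
    by_contra huv
    exact h (signedForm_carryingSum_eq_zero_of_eq_right R huv hrow hcol)

theorem isUnit_colForm_rowSum (p : TableauPair n) : IsUnit (colForm R p (rowSum R p)) := by
  obtain ⟨l, s, t⟩ := p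
  have hinter : carrying (entryRow s) (entryRow t) ∩ carrying (entryCol s) (entryCol t)
      = {t.1.symm.trans s.1} := by
    ext π
    rw [Finset.mem_inter, mem_carrying, mem_carrying, Finset.mem_singleton,
      forall_entryRow_eq_and_entryCol_eq_iff]
  rw [colForm, rowSum, signedForm_carryingSum, hinter, Finset.sum_singleton]
  exact (Units.isUnit _).map (Int.castRingHom R)

theorem isUnit_det_colForm_rowSum {κ : Type*} [Fintype κ] [DecidableEq κ] {p : κ → TableauPair n}
    (hp : Function.Injective p) :
    IsUnit (Matrix.of fun i j => colForm R (p i) (rowSum R (p j))).det :=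
  isUnit_det_of_triangular (pairSpread_injective.comp hp)
    (fun _ _ => pairSpread_le_of_colForm_ne_zero R) fun i => isUnit_colForm_rowSum R (p i)

theorem linearIndependent_rowSum : LinearIndependent R (rowSum (n := n) R) := by
  classical
  exact linearIndependent_of_isUnit_det (isUnit_det_colForm_rowSum R Function.injective_id)

theorem card_tableauPair_mem (Δ : Finset n.Partition) :
    Fintype.card {p : TableauPair n // p.1 ∈ Δ} = ∑ l ∈ Δ, l.numStandard ^ 2 := by
  rw [Fintype.card_subtype, Finset.card_eq_sum_card_fiberwise (f := Sigma.fst) (t := Δ)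
    (fun p hp => by simpa using hp)]
  refine Finset.sum_congr rfl fun l hl => ?_
  rw [Finset.filter_filter, ← Fintype.card_subtype, sq, Nat.Partition.numStandard,
    Nat.card_eq_fintype_card, ← Fintype.card_prod]
  refine Fintype.card_congr ((Equiv.subtypeEquivRight fun p => ?_).trans
    (Equiv.sigmaSubtype (β := fun l : n.Partition => l.StandardTableau × l.StandardTableau) l))
  exact ⟨fun h => h.2, fun h => ⟨h ▸ hl, h⟩⟩

theorem card_tableauPair_eq_sum :
    Fintype.card (TableauPair n) = ∑ l : n.Partition, l.numStandard ^ 2 := by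
  simp [Fintype.card_sigma, sq, Nat.Partition.numStandard]

theorem card_tableauPair : Fintype.card (TableauPair n) = n.factorial := by
  refine le_antisymm ?_
    (card_tableauPair_eq_sum (n := n) ▸ RobinsonSchensted.factorial_le_sum_numStandard_sq n)
  have := Module.Finite.of_basis (MonoidAlgebra.basis (Equiv.Perm (Fin n)) ℤ)
  have hle := (linearIndependent_rowSum (n := n) ℤ).fintype_card_le_finrank
  rwa [Module.finrank_eq_card_basis (MonoidAlgebra.basis (Equiv.Perm (Fin n)) ℤ),
    Fintype.card_perm, Fintype.card_fin] at hle

theorem card_shape_eq (l : n.Partition) :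
    Nat.card {σ : Equiv.Perm (Fin n) // RobinsonSchensted.shape σ = l} = l.numStandard ^ 2 := by
  have hsum : ∑ l : n.Partition, Nat.card {σ : Equiv.Perm (Fin n) // RobinsonSchensted.shape σ = l}
      = ∑ l : n.Partition, l.numStandard ^ 2 := by
    rw [← RobinsonSchensted.card_shape_mem, ← card_tableauPair_eq_sum, card_tableauPair]
    simp [Nat.card_eq_fintype_card, Fintype.card_perm]
  exact (Finset.sum_eq_sum_iff_of_le fun l _ => RobinsonSchensted.card_shape_eq_le l).1 hsum l
    (Finset.mem_univ l)

theorem card_shape_mem (Γ : Finset n.Partition) :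
    Nat.card {σ : Equiv.Perm (Fin n) // RobinsonSchensted.shape σ ∈ Γ}
      = ∑ l ∈ Γ, l.numStandard ^ 2 := by
  rw [RobinsonSchensted.card_shape_mem]
  exact Finset.sum_congr rfl fun l _ => card_shape_eq l

theorem span_rowSum : Submodule.span R (Set.range (rowSum (n := n) R)) = ⊤ := by
  classical
  have hcard : Fintype.card (Equiv.Perm (Fin n)) = Fintype.card (TableauPair n) := by
    rw [card_tableauPair, Fintype.card_perm, Fintype.card_fin]
  exact span_eq_top_of_isUnit_det
    ((MonoidAlgebra.basis _ R).reindex (Fintype.equivOfCardEq hcard))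
    (isUnit_det_colForm_rowSum R Function.injective_id)

variable {Δ : Finset n.Partition}

theorem rowSum_mem_youngIdeal {p : TableauPair n} (hp : p.1 ∈ Δ) : rowSum R p ∈ youngIdeal R Δ :=
  carryingSum_mem_youngIdeal R hp (hasContent_entryRow p.2.1) (hasContent_entryRow p.2.2)

theorem colForm_eq_zero_of_mem_youngIdeal (hΔ : IsUpperSet (Δ : Set n.Partition))
    {p : TableauPair n} (hp : p.1 ∉ Δ) {x : MonoidAlgebra R (Equiv.Perm (Fin n))}
    (hx : x ∈ youngIdeal R Δ) : colForm R p x = 0 := by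
  refine signedForm_eq_zero_of_mem_youngIdeal R (fun l hl b hb => ?_) hx
  by_contra! hne
  refine hp (hΔ (a := l) (fun k => ?_) hl)
  rw [← hb.spread_self, ← (hasContent_entryRow p.2.2).spread_self]
  exact spread_le_spread_entryRow p.2.2
    (fun u v hb ht => by_contra fun huv => hne u v huv hb ht) n k

theorem youngIdeal_eq_span (hΔ : IsUpperSet (Δ : Set n.Partition)) : youngIdeal R Δ
    = Submodule.span R (Set.range fun p : {p : TableauPair n // p.1 ∈ Δ} => rowSum R p.1) := by
  classical
  set V := Submodule.span R (Set.range fun p : {p : TableauPair n // p.1 ∈ Δ} => rowSum R p.1)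
  have hV : V ≤ youngIdeal R Δ :=
    Submodule.span_le.2 (Set.range_subset_iff.2 fun p => rowSum_mem_youngIdeal R p.2)
  refine le_antisymm (fun x hx => ?_) hV
  obtain ⟨c, rfl⟩ := (Submodule.mem_span_range_iff_exists_fun R).1
    ((span_rowSum R).symm ▸ Submodule.mem_top : x ∈ _)
  have hsplit := Fintype.sum_subtype_add_sum_subtype (fun p : TableauPair n => p.1 ∈ Δ)
    fun p => c p • rowSum R p
  have hinside : ∑ p : {p : TableauPair n // p.1 ∈ Δ}, c p • rowSum R p.1 ∈ V :=
    Submodule.sum_mem _ fun p _ => Submodule.smul_mem _ _ (Submodule.subset_span ⟨p, rfl⟩)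
  have houtside : ∑ p : {p : TableauPair n // p.1 ∉ Δ}, c p • rowSum R p.1 ∈ youngIdeal R Δ := by
    rw [← hsplit] at hx
    exact (Submodule.add_mem_iff_right _ (hV hinside)).1 hx
  have hzero : (fun p : {p : TableauPair n // p.1 ∉ Δ} => c p) = 0 :=
    eq_zero_of_forall_apply_sum_eq_zero (isUnit_det_colForm_rowSum R Subtype.val_injective)
      fun p => colForm_eq_zero_of_mem_youngIdeal R hΔ p.2 houtside
  rw [← hsplit, Finset.sum_eq_zero (s := (Finset.univ : Finset {p : TableauPair n // p.1 ∉ Δ}))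
    fun p _ => by rw [congrFun hzero p, Pi.zero_apply, zero_smul], add_zero]
  exact hinside

/-- The basis of `youngIdeal R Δ`, for an upper set `Δ`, that consists of the row sums of the
tableau pairs with shape in `Δ`. -/
noncomputable def youngIdealBasis (hΔ : IsUpperSet (Δ : Set n.Partition)) :
    Module.Basis {p : TableauPair n // p.1 ∈ Δ} R (youngIdeal R Δ) :=
  (Module.Basis.span ((linearIndependent_rowSum R).comp (Subtype.val :
    {p : TableauPair n // p.1 ∈ Δ} → TableauPair n) Subtype.val_injective)).map
    (LinearEquiv.ofEq _ _ (youngIdeal_eq_span R hΔ).symm)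

theorem youngIdealBasis_apply (hΔ : IsUpperSet (Δ : Set n.Partition))
    (p : {p : TableauPair n // p.1 ∈ Δ}) :
    (youngIdealBasis R hΔ p : MonoidAlgebra R (Equiv.Perm (Fin n))) = rowSum R p.1 := by
  rw [youngIdealBasis, Module.Basis.map_apply, LinearEquiv.coe_ofEq_apply, Module.Basis.span_apply]
  rfl

end SymGroupAlgebra

/-! ## Leading permutations -/

namespace SymGroupAlgebra

open IntegerPartition LinearPairing RobinsonSchensted

variable {n : ℕ}

/-- The lexicographic order of the words of the permutations. -/
noncomputable abbrev lexOrder (n : ℕ) : LinearOrder (Equiv.Perm (Fin n)) :=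
  LinearOrder.lift' (fun σ => toLex ⇑σ) (toLex.injective.comp DFunLike.coe_injective)

attribute [local instance] lexOrder

theorem lt_of_mem_carrying {c : Fin n → ℕ} {σ π : Equiv.Perm (Fin n)}
    (hσ : ∀ i j, i < j → c (σ i) = c (σ j) → σ i < σ j) (hπ : π ∈ carrying c (c ∘ ⇑σ))
    (hne : π ≠ σ) : σ < π := by
  rw [mem_carrying] at hπ
  obtain ⟨i, hi, hfirst⟩ := WellFounded.has_min (wellFounded_lt (α := Fin n)) {i | π i ≠ σ i}
    (DFunLike.ne_iff.1 hne)
  have hagree : ∀ j < i, σ j = π j := fun j hj => by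
    by_contra h
    exact hfirst j (Ne.symm h) hj
  obtain ⟨j, hj⟩ := σ.surjective (π i)
  have hij : i < j := by
    rcases lt_trichotomy i j with h | rfl | h
    · exact h
    · exact absurd hj.symm hi
    · rw [hagree j h] at hj
      exact absurd (π.injective hj) h.ne
  refine ⟨i, hagree, ?_⟩
  change σ i < π i
  rw [← hj]
  exact hσ i j hij (by rw [hj, hπ, Function.comp_apply])

variable (K : Type*) [Field K] {Δ : Finset n.Partition}

theorem card_shape_conj_mem (Δ : Finset n.Partition) :
    Nat.card {σ : Equiv.Perm (Fin n) // (shape σ).conj ∈ Δ} = ∑ l ∈ Δ, l.numStandard ^ 2 := by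
  have hmem (σ : Equiv.Perm (Fin n)) :
      (shape σ).conj ∈ Δ ↔ shape σ ∈ Δ.image Nat.Partition.conj := by
    rw [Finset.mem_image]
    exact ⟨fun h => ⟨_, h, conj_conj _⟩, fun ⟨l, hl, h⟩ => by rwa [← h, conj_conj]⟩
  have hinj : Function.Injective (Nat.Partition.conj (n := n)) :=
    Function.Involutive.injective conj_conj
  simp only [hmem, card_shape_mem, Finset.sum_image hinj.injOn, numStandard_conj]

theorem ncard_leadingIndices_youngIdeal (P : n.Partition → Prop) [DecidablePred P]
    (hP : IsLowerSet {l | P l}) :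
    (leadingIndices (MonoidAlgebra.basis _ K) (youngIdeal K
      (Finset.univ.filter fun l : n.Partition => P l.conj))).ncard
      = {σ : Equiv.Perm (Fin n) | P (shape σ)}.ncard := by
  have hupper : IsUpperSet
      {l | l ∈ Finset.univ.filter fun l : n.Partition => P l.conj} :=
    fun _ _ hle h => by simpa using hP (conj_antitone hle) (by simpa using h)
  have hset : {σ : Equiv.Perm (Fin n) | P (shape σ)}
      = {σ | (shape σ).conj ∈ Finset.univ.filter fun l : n.Partition => P l.conj} := by
    ext
    simp [conj_conj]
  calc _ = Module.finrank K _ := card_leadingIndices _ _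
    _ = ∑ l ∈ Finset.univ.filter fun l : n.Partition => P l.conj, l.numStandard ^ 2 := by
      rw [Module.finrank_eq_card_basis (youngIdealBasis K hupper), card_tableauPair_mem]
    _ = _ := hset ▸ (card_shape_conj_mem _).symm

theorem youngIdeal_mono (R : Type*) [CommRing R] : Monotone (youngIdeal (n := n) R) :=
  fun _ _ h _ hx => TwoSidedIdeal.span_mono (by rintro _ ⟨l, hl, rfl⟩; exact ⟨l, h hl, rfl⟩) hx

/-- Schensted's colouring of `σ` makes `σ` the smallest permutation that contributes to a signed
form which kills the ideal. -/
theorem partialSum_shape_lt_of_mem_leadingIndices {k m : ℕ}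
    (hΔ : ∀ l ∈ Δ, l.conj.partialSum k < m) {σ : Equiv.Perm (Fin n)}
    (hσ : σ ∈ leadingIndices (MonoidAlgebra.basis _ K) (youngIdeal K Δ)) :
    (shape σ).partialSum k < m := by
  obtain ⟨x, hx, hne, hgt⟩ := hσ
  by_contra! hm
  obtain ⟨c, hinc, hc⟩ := exists_increasing_colouring σ k
  have hcard : (Finset.univ.filter fun v => (c ∘ ⇑σ) v < k).card
      = (Finset.univ.filter fun v => c v < k).card := Finset.card_equiv σ fun v => by simp
  have hzero : signedForm K c (c ∘ ⇑σ) x = 0 := by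
    refine signedForm_eq_zero_of_mem_youngIdeal K (fun l hl b hb => ?_) hx
    by_contra! hsep
    have hle := hb.card_filter_lt_le_partialSum_conj
      (fun u v hb hc => by_contra fun huv => hsep u v huv hb hc) k
    have := hΔ l hl
    omega
  have hself : σ ∈ carrying c (c ∘ ⇑σ) := mem_carrying.2 fun _ => rfl
  rw [signedForm_apply, Finset.sum_eq_single_of_mem σ hself
    fun π hπ hπσ => by rw [hgt π (lt_of_mem_carrying hinc hπ hπσ), mul_zero]] at hzero
  exact hne (((Units.isUnit _).map (Int.castRingHom K)).mul_right_eq_zero.1 hzero)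

theorem leadingIndices_youngIdeal_partialSum_lt (k m : ℕ) :
    leadingIndices (MonoidAlgebra.basis _ K) (youngIdeal K
      (Finset.univ.filter fun l : n.Partition => l.conj.partialSum k < m))
      = {σ : Equiv.Perm (Fin n) | (shape σ).partialSum k < m} := by
  refine Set.eq_of_subset_of_ncard_le
    (fun σ => partialSum_shape_lt_of_mem_leadingIndices K fun l hl => by simpa using hl) ?_
  exact (ncard_leadingIndices_youngIdeal K (fun l => l.partialSum k < m)
    fun _ _ hle hlt => (hle k).trans_lt hlt).ge

open Classical in
theorem leadingIndices_youngIdeal_not_le (ν : n.Partition) :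
    leadingIndices (MonoidAlgebra.basis _ K) (youngIdeal K
      (Finset.univ.filter fun l : n.Partition => ¬ ν ≤ l.conj))
      = {σ : Equiv.Perm (Fin n) | ¬ ν ≤ shape σ} := by
  refine (Set.eq_of_subset_of_ncard_le (fun σ hσ => ?_) ?_).symm
  · obtain ⟨k, hk⟩ : ∃ k, (shape σ).partialSum k < ν.partialSum k := by
      by_contra! h
      exact hσ h
    refine leadingIndices_mono _ (youngIdeal_mono K fun l hl => ?_)
      ((leadingIndices_youngIdeal_partialSum_lt K k (ν.partialSum k)).ge hk)
    rw [Finset.mem_filter] at hl ⊢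
    exact ⟨hl.1, fun h => (h k).not_gt hl.2⟩
  · exact (ncard_leadingIndices_youngIdeal K (fun l => ¬ ν ≤ l)
      fun _ _ hle hν (h : ν ≤ _) => hν (h.trans hle)).le

theorem conj_shape_mem_of_mem_leadingIndices (hΔ : IsUpperSet (Δ : Set n.Partition))
    {σ : Equiv.Perm (Fin n)}
    (hσ : σ ∈ leadingIndices (MonoidAlgebra.basis _ K) (youngIdeal K Δ)) :
    (shape σ).conj ∈ Δ := by
  classical
  by_contra hnot
  have hsub : Δ ⊆ Finset.univ.filter fun l : n.Partition => ¬ shape σ ≤ l.conj := fun l hl => by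
    refine Finset.mem_filter.2 ⟨Finset.mem_univ l, fun hle => hnot (hΔ (a := l) ?_ hl)⟩
    simpa only [conj_conj] using conj_antitone hle
  have hmem := leadingIndices_mono _ (youngIdeal_mono K hsub) hσ
  rw [leadingIndices_youngIdeal_not_le] at hmem
  exact hmem le_rfl

theorem disjoint_spanG_youngIdeal {Γ : Finset n.Partition} (hΔ : IsUpperSet (Δ : Set n.Partition))
    (hΓ : ∀ l ∈ Γ, l.conj ∉ Δ) : Disjoint (spanG K Γ) (youngIdeal K Δ) := by
  rw [Submodule.disjoint_def]
  intro x hxΓ hxΔ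
  by_contra hx
  obtain ⟨σ, hσ, hgt⟩ := exists_leading_index (MonoidAlgebra.basis _ K) hx
  have hsupp : ↑((MonoidAlgebra.basis _ K).repr x).support ⊆ {σ | shape σ ∈ Γ} := by
    rw [← Module.Basis.mem_span_image]
    rwa [spanG, coe_of_eq_coe_basis] at hxΓ
  exact hΓ _ (hsupp (Finsupp.mem_support_iff.2 hσ))
    (conj_shape_mem_of_mem_leadingIndices K hΔ ⟨x, hxΔ, hσ, hgt⟩)

end SymGroupAlgebra

/-! ## Change of coefficients -/

namespace SymGroupAlgebra

open IntegerPartition RobinsonSchensted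

variable {n : ℕ} (R : Type*) [CommRing R]

theorem fromInt_of (σ : Equiv.Perm (Fin n)) :
    fromInt R (MonoidAlgebra.of ℤ _ σ) = MonoidAlgebra.of R _ σ := by
  simp [fromInt]

theorem fromInt_carryingSum (f g : Fin n → ℕ) :
    fromInt R (carryingSum ℤ f g) = carryingSum R f g := by
  rw [carryingSum, carryingSum, map_sum]
  exact Finset.sum_congr rfl fun σ _ => fromInt_of R σ

theorem basis_repr_fromInt (x : MonoidAlgebra ℤ (Equiv.Perm (Fin n))) (σ : Equiv.Perm (Fin n)) :
    (MonoidAlgebra.basis _ R).repr (fromInt R x) σ = ((MonoidAlgebra.basis _ ℤ).repr x σ : R) := by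
  simp [fromInt, MonoidAlgebra.basis]

section

variable {ι : Type*} [Fintype ι] {v : ι → MonoidAlgebra ℤ (Equiv.Perm (Fin n))}

theorem det_fromInt_comp [DecidableEq ι] (ε : Equiv.Perm (Fin n) ≃ ι) :
    ((MonoidAlgebra.basis _ R).reindex ε).det (fromInt R ∘ v)
      = (((MonoidAlgebra.basis _ ℤ).reindex ε).det v : R) := by
  rw [Module.Basis.det_apply, Module.Basis.det_apply, Int.cast_det]
  refine congrArg Matrix.det (Matrix.ext fun i j => ?_)
  simp [Module.Basis.toMatrix_apply, basis_repr_fromInt]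

theorem isUnit_det_of_forall_prime [DecidableEq ι] (ε : Equiv.Perm (Fin n) ≃ ι)
    (hv : ∀ p : ℕ, p.Prime → LinearIndependent (ZMod p) (fromInt (ZMod p) ∘ v)) :
    IsUnit (((MonoidAlgebra.basis _ ℤ).reindex ε).det v) := by
  by_contra hunit
  obtain ⟨p, hp, hdvd⟩ := Nat.exists_prime_and_dvd (mt Int.isUnit_iff_natAbs_eq.2 hunit)
  have : Fact p.Prime := ⟨hp⟩
  let e := (MonoidAlgebra.basis (Equiv.Perm (Fin n)) (ZMod p)).reindex ε
  have hspan : Submodule.span (ZMod p) (Set.range (fromInt (ZMod p) ∘ v)) = ⊤ :=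
    (hv p hp).span_eq_top_of_card_eq_finrank' (Module.finrank_eq_card_basis e).symm
  refine (e.is_basis_iff_det.1 ⟨hv p hp, hspan⟩).ne_zero ?_
  rw [det_fromInt_comp, ZMod.intCast_zmod_eq_zero_iff_dvd]
  exact Int.natCast_dvd.2 hdvd

theorem linearIndependent_and_span_eq_top_of_forall_prime (hcard : Fintype.card ι = n.factorial)
    (hv : ∀ p : ℕ, p.Prime → LinearIndependent (ZMod p) (fromInt (ZMod p) ∘ v)) :
    LinearIndependent R (fromInt R ∘ v) ∧ Submodule.span R (Set.range (fromInt R ∘ v)) = ⊤ := by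
  classical
  have ε : Equiv.Perm (Fin n) ≃ ι :=
    Fintype.equivOfCardEq (by rw [hcard, Fintype.card_perm, Fintype.card_fin])
  rw [((MonoidAlgebra.basis _ R).reindex ε).is_basis_iff_det, det_fromInt_comp]
  exact (isUnit_det_of_forall_prime ε hv).map (Int.castRingHom R)

end

/-! ## The complement -/

variable {Γ Δ : Finset n.Partition}

/-- The permutations with shape in `Γ` followed by the row sums with shape in `Δ`. -/
noncomputable def shapeFamily (Γ Δ : Finset n.Partition) :
    {σ : Equiv.Perm (Fin n) // shape σ ∈ Γ} ⊕ {p : TableauPair n // p.1 ∈ Δ} →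
      MonoidAlgebra R (Equiv.Perm (Fin n)) :=
  Sum.elim (fun σ => MonoidAlgebra.of R _ σ.1) fun p => rowSum R p.1

theorem fromInt_comp_shapeFamily : fromInt R ∘ shapeFamily ℤ Γ Δ = shapeFamily R Γ Δ := by
  funext i
  rcases i with σ | p
  · exact fromInt_of R σ.1
  · exact fromInt_carryingSum R _ _

theorem card_shapeFamily (hΔ : ∀ l, l ∈ Δ ↔ l.conj ∉ Γ) :
    Fintype.card ({σ : Equiv.Perm (Fin n) // shape σ ∈ Γ} ⊕ {p : TableauPair n // p.1 ∈ Δ})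
      = n.factorial := by
  have hcompl : Fintype.card {p : TableauPair n // p.1 ∈ Δ}
      = Fintype.card {σ : Equiv.Perm (Fin n) // shape σ ∉ Γ} := by
    rw [card_tableauPair_mem, ← card_shape_conj_mem, Nat.card_eq_fintype_card]
    simp only [hΔ, conj_conj]
  rw [Fintype.card_sum, hcompl, ← Fintype.card_sum, Fintype.card_congr (Equiv.sumCompl _),
    Fintype.card_perm, Fintype.card_fin]

theorem span_range_of_shape_mem :
    Submodule.span R (Set.range fun σ : {σ : Equiv.Perm (Fin n) // shape σ ∈ Γ} =>
      MonoidAlgebra.of R _ σ.1) = spanG R Γ := by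
  rw [spanG, Set.image_eq_range]
  rfl

theorem linearIndependent_shapeFamily (K : Type*) [Field K]
    (hΔ : IsUpperSet (Δ : Set n.Partition)) (hΓ : ∀ l ∈ Γ, l.conj ∉ Δ) :
    LinearIndependent K (shapeFamily K Γ Δ) := by
  have hperm : LinearIndependent K (MonoidAlgebra.of K (Equiv.Perm (Fin n))) :=
    coe_of_eq_coe_basis (n := n) K ▸ (MonoidAlgebra.basis _ K).linearIndependent
  refine (hperm.comp _ Subtype.val_injective).sum_type
    ((linearIndependent_rowSum K).comp _ Subtype.val_injective) ?_
  have hdisj := disjoint_spanG_youngIdeal K hΔ hΓ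
  rwa [← span_range_of_shape_mem, youngIdeal_eq_span K hΔ] at hdisj

theorem isCompl_spanG_youngIdeal (hupper : IsUpperSet (Δ : Set n.Partition))
    (hΔ : ∀ l, l ∈ Δ ↔ l.conj ∉ Γ) : IsCompl (spanG R Γ) (youngIdeal R Δ) := by
  have hΓ (l : n.Partition) (hl : l ∈ Γ) : l.conj ∉ Δ := by rwa [hΔ, conj_conj, not_not]
  have hbasis := linearIndependent_and_span_eq_top_of_forall_prime R (card_shapeFamily hΔ)
    (v := shapeFamily ℤ Γ Δ) fun p hp => by
      have : Fact p.Prime := ⟨hp⟩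
      exact fromInt_comp_shapeFamily (n := n) (ZMod p) ▸
        linearIndependent_shapeFamily (ZMod p) hupper hΓ
  rw [fromInt_comp_shapeFamily, linearIndependent_sum, shapeFamily, Set.Sum.elim_range,
    Submodule.span_union, span_range_of_shape_mem, ← youngIdeal_eq_span R hupper] at hbasis
  obtain ⟨⟨-, -, hdisj⟩, hsup⟩ := hbasis
  rw [Sum.elim_comp_inl, Sum.elim_comp_inr, span_range_of_shape_mem,
    ← youngIdeal_eq_span R hupper] at hdisj
  exact ⟨hdisj, codisjoint_iff.2 hsup⟩

end SymGroupAlgebra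

/-! ## Signs and base change -/

namespace SymGroupAlgebra

variable {n : ℕ} (R : Type*) [CommRing R]

theorem dagger_of (σ : Equiv.Perm (Fin n)) :
    dagger R (MonoidAlgebra.of R _ σ)
      = ((Equiv.Perm.sign σ : ℤ) : R) • MonoidAlgebra.of R _ σ := by
  change daggerHom R (MonoidAlgebra.single σ 1) = _
  rw [daggerHom_single]
  simp

theorem fromInt_dagger (x : MonoidAlgebra ℤ (Equiv.Perm (Fin n))) :
    fromInt R (dagger ℤ x) = dagger R (fromInt R x) := by
  induction x using MonoidAlgebra.induction_on with
  | of σ =>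
    rw [fromInt_of, dagger_of, dagger_of, Int.cast_id, map_zsmul, fromInt_of,
      Int.cast_smul_eq_zsmul]
  | add x y hx hy => simp only [map_add, hx, hy]
  | smul r x hx => rw [map_smul, map_zsmul, map_zsmul, map_zsmul, hx]

theorem map_dagger_spanG (Γ : Finset n.Partition) :
    (spanG R Γ).map (dagger R).toLinearMap = spanG R Γ := by
  have hle : (spanG R Γ).map (dagger R).toLinearMap ≤ spanG R Γ := by
    rw [Submodule.map_le_iff_le_comap, spanG, Submodule.span_le]
    rintro _ ⟨σ, hσ, rfl⟩
    change dagger R (MonoidAlgebra.of R _ σ) ∈ spanG R Γ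
    rw [dagger_of]
    exact Submodule.smul_mem _ _ (Submodule.subset_span ⟨σ, hσ, rfl⟩)
  exact le_antisymm hle fun x hx =>
    ⟨dagger R x, hle ⟨x, hx, rfl⟩, DFunLike.congr_fun (daggerHom_comp R) x⟩

theorem isCompl_spanG_youngIdealDagger {Γ Δ : Finset n.Partition}
    (h : IsCompl (spanG R Γ) (youngIdeal R Δ)) : IsCompl (spanG R Γ) (youngIdealDagger R Δ) := by
  rw [← map_dagger_spanG]
  exact h.map (Submodule.orderIsoMapComap (dagger R).toLinearEquiv)

theorem exists_baseChange_equiv {ι : Type*}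
    {N : Submodule ℤ (MonoidAlgebra ℤ (Equiv.Perm (Fin n)))}
    {N' : Submodule R (MonoidAlgebra R (Equiv.Perm (Fin n)))}
    (b : Module.Basis ι ℤ N) (b' : Module.Basis ι R N')
    (hb : ∀ i, fromInt R (b i).1 = (b' i).1) :
    ∃ e : R ⊗[ℤ] N ≃ₗ[R] N', ∀ (r : R) (x : N),
      (e (r ⊗ₜ[ℤ] x) : MonoidAlgebra R (Equiv.Perm (Fin n))) = r • fromInt R x.1 := by
  let e := (b.baseChange R).equiv b' (Equiv.refl ι)
  have hone : (N'.subtype.restrictScalars ℤ ∘ₗ e.toLinearMap.restrictScalars ℤ ∘ₗ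
      TensorProduct.mk ℤ R N 1) = (fromInt R).toAddMonoidHom.toIntLinearMap ∘ₗ N.subtype := by
    refine b.ext fun i => ?_
    change (e (1 ⊗ₜ[ℤ] b i)).1 = fromInt R (b i).1
    rw [← Module.Basis.baseChange_apply, Module.Basis.equiv_apply, Equiv.refl_apply, hb]
  refine ⟨e, fun r x => ?_⟩
  have hr : r ⊗ₜ[ℤ] x = r • ((1 : R) ⊗ₜ[ℤ] x) := by
    rw [TensorProduct.smul_tmul', smul_eq_mul, mul_one]
  rw [hr, map_smul, Submodule.coe_smul]
  exact congrArg (r • ·) (LinearMap.congr_fun hone x)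

variable {Δ : Finset n.Partition}

/-- The image of `youngIdealBasis` under `†`. -/
noncomputable def youngIdealDaggerBasis (hΔ : IsUpperSet (Δ : Set n.Partition)) :
    Module.Basis {p : TableauPair n // p.1 ∈ Δ} R (youngIdealDagger R Δ) :=
  (youngIdealBasis R hΔ).map ((dagger R).toLinearEquiv.submoduleMap (youngIdeal R Δ))

theorem fromInt_youngIdealBasis (hΔ : IsUpperSet (Δ : Set n.Partition))
    (p : {p : TableauPair n // p.1 ∈ Δ}) :
    fromInt R (youngIdealBasis ℤ hΔ p).1 = (youngIdealBasis R hΔ p).1 := by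
  rw [youngIdealBasis_apply, youngIdealBasis_apply]
  exact fromInt_carryingSum R _ _

theorem fromInt_youngIdealDaggerBasis (hΔ : IsUpperSet (Δ : Set n.Partition))
    (p : {p : TableauPair n // p.1 ∈ Δ}) :
    fromInt R (youngIdealDaggerBasis ℤ hΔ p).1 = (youngIdealDaggerBasis R hΔ p).1 :=
  (fromInt_dagger R _).trans (congrArg (dagger R) (fromInt_youngIdealBasis R hΔ p))

end SymGroupAlgebra

theorem proposition2p8_general (n : ℕ) (R : Type*) [CommRing R]
    (Γ : Finset n.Partition) (hΓ : IsUpperSet (Γ : Set n.Partition))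
    (Δ : Finset n.Partition) (hΔ : Δ = Finset.univ \ Γ.image Nat.Partition.conj) :
    (IsCompl (SymGroupAlgebra.spanG R Γ) (SymGroupAlgebra.youngIdeal R Δ) ∧
      IsCompl (SymGroupAlgebra.spanG R Γ) (SymGroupAlgebra.youngIdealDagger R Δ)) ∧
    (Nonempty (Module.Basis (Fin (∑ l ∈ Δ, l.numStandard ^ 2)) R
        (SymGroupAlgebra.youngIdeal R Δ)) ∧
      ∃ e : R ⊗[ℤ] SymGroupAlgebra.youngIdeal ℤ Δ ≃ₗ[R] SymGroupAlgebra.youngIdeal R Δ,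
        ∀ (r : R) (x : SymGroupAlgebra.youngIdeal ℤ Δ),
          (e (r ⊗ₜ[ℤ] x) : MonoidAlgebra R (Equiv.Perm (Fin n)))
            = r • SymGroupAlgebra.fromInt R x.1) ∧
    (Nonempty (Module.Basis (Fin (∑ l ∈ Δ, l.numStandard ^ 2)) R
        (SymGroupAlgebra.youngIdealDagger R Δ)) ∧
      ∃ e : R ⊗[ℤ] SymGroupAlgebra.youngIdealDagger ℤ Δ ≃ₗ[R]
          SymGroupAlgebra.youngIdealDagger R Δ,
        ∀ (r : R) (x : SymGroupAlgebra.youngIdealDagger ℤ Δ),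
          (e (r ⊗ₜ[ℤ] x) : MonoidAlgebra R (Equiv.Perm (Fin n)))
            = r • SymGroupAlgebra.fromInt R x.1) := by
  subst hΔ
  have hupper := IntegerPartition.isUpperSet_compl_image_conj hΓ
  have hcompl := SymGroupAlgebra.isCompl_spanG_youngIdeal R hupper fun _ =>
    IntegerPartition.mem_compl_image_conj
  let ε := Fintype.equivFinOfCardEq
    (SymGroupAlgebra.card_tableauPair_mem (Finset.univ \ Γ.image Nat.Partition.conj))
  exact ⟨⟨hcompl, SymGroupAlgebra.isCompl_spanG_youngIdealDagger R hcompl⟩,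
    ⟨⟨(SymGroupAlgebra.youngIdealBasis R hupper).reindex ε⟩,
      SymGroupAlgebra.exists_baseChange_equiv R _ _
        (SymGroupAlgebra.fromInt_youngIdealBasis R hupper)⟩,
    ⟨(SymGroupAlgebra.youngIdealDaggerBasis R hupper).reindex ε⟩,
      SymGroupAlgebra.exists_baseChange_equiv R _ _
        (SymGroupAlgebra.fromInt_youngIdealDaggerBasis R hupper)⟩

theorem proposition2p8 (n : ℕ) (hn : 0 < n) (R : Type*) [CommRing R]
    (Γ : Finset n.Partition) (hΓ : IsUpperSet (Γ : Set n.Partition))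
    (hmin : ∃! μ : n.Partition, Minimal (· ∈ Γ) μ)
    (Δ : Finset n.Partition) (hΔ : Δ = Finset.univ \ Γ.image Nat.Partition.conj) :
    (IsCompl (SymGroupAlgebra.spanG R Γ) (SymGroupAlgebra.youngIdeal R Δ) ∧
      IsCompl (SymGroupAlgebra.spanG R Γ) (SymGroupAlgebra.youngIdealDagger R Δ)) ∧
    (Nonempty (Module.Basis (Fin (∑ l ∈ Δ, l.numStandard ^ 2)) R
        (SymGroupAlgebra.youngIdeal R Δ)) ∧
      ∃ e : R ⊗[ℤ] SymGroupAlgebra.youngIdeal ℤ Δ ≃ₗ[R] SymGroupAlgebra.youngIdeal R Δ,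
        ∀ (r : R) (x : SymGroupAlgebra.youngIdeal ℤ Δ),
          (e (r ⊗ₜ[ℤ] x) : MonoidAlgebra R (Equiv.Perm (Fin n)))
            = r • SymGroupAlgebra.fromInt R x.1) ∧
    (Nonempty (Module.Basis (Fin (∑ l ∈ Δ, l.numStandard ^ 2)) R
        (SymGroupAlgebra.youngIdealDagger R Δ)) ∧
      ∃ e : R ⊗[ℤ] SymGroupAlgebra.youngIdealDagger ℤ Δ ≃ₗ[R]
          SymGroupAlgebra.youngIdealDagger R Δ,
        ∀ (r : R) (x : SymGroupAlgebra.youngIdealDagger ℤ Δ),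
          (e (r ⊗ₜ[ℤ] x) : MonoidAlgebra R (Equiv.Perm (Fin n)))
            = r • SymGroupAlgebra.fromInt R x.1) :=
  proposition2p8_general n R Γ hΓ Δ hΔ
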